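/- Let $T_m(x)=e^{-x}\sum_{k\ge 0}k^m x^k/k!$ denote the Touchard polynomials. For $\mu>0$ the equation $te^t=\mu$ has exactly one positive root, $t=W(\mu)$. For $t>0$ put $\mu=te^t$, $\psi(u)=e^u/\mu-\log u$, let $a_r$ be the Taylor coefficients in $\psi(u)-\psi(t)=\sum_{r\ge 0}a_r(u-t)^{r+2}$ near the saddle point $u=t$, let $\mathcal B_{k,j}$ be the partial ordinary Bell polynomials ($\mathcal B_{k,0}=\delta_{k0}$, $\mathcal B_{k,j}=\sum_{r=1}^{k-j+1}a_r\mathcal B_{k-r,j-1}$), and set $$c_{2s}(t)=\frac{(-1)^s}{a_0^s}\sum_{j=0}^{2s}\frac{(-1)^j(s+\frac12)_j}{j!\,a_0^j}\,\mathcal B_{2s,j},\qquad (\alpha)_j=\alpha(\alpha+1)\cdots(\alpha+j-1).$$ **Theorem 1.** Let $x>0$ be fixed, or vary with $n$ so that it is bounded away from $0$ and is at most $O(n)$. Put $\mu=n/x$ and $t_0=W(\mu)$. Then, as $n\to\infty$, $T_{n-1}(x)$ has the asymptotic expansion (in which exponentially smaller contributions are absorbed in the error terms) $$T_{n-1}(x)\sim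 \frac{\Gamma(n)\,e^{-x+n/t_0}}{\sqrt{2\pi(1+t_0)}\;t_0^{\,n-1}}\sum_{s=0}^{\infty}\frac{c_{2s}(t_0)\,\Gamma(s+\frac12)}{n^{s+\frac12}\,\Gamma(\frac12)}.$$ Precisely: for all $\delta,C>0$ and every integer $N\ge 0$ there is a constant $K$ such that, for all sufficiently large $n$ and all $x$ with $\delta\le x\le Cn$, $$\left|T_{n-1}(x)-\frac{\Gamma(n)e^{-x+n/t_0}}{\sqrt{2\pi(1+t_0)}\,t_0^{n-1}}\sum_{s=0}^{N-1}\frac{c_{2s}(t_0)\Gamma(s+\frac12)}{n^{s+\frac12}\Gamma(\frac12)}\right|\le K\,\frac{\Gamma(n)e^{-x+n/t_0}}{\sqrt{2\pi(1+t_0)}\,t_0^{n-1}}\,n^{-1/2}\Bigl(\frac{t_0}{n}\Bigr)^{N}.$$ Here $W(1/C)\le t_0\le\log(1+n/\delta)$, so the scale $(t_0/n)^N$ is $O(n^{-N})$ when $x$ is of order $n$ and $O((\log n/n)^N)$ when $x$ is fixed. Moreover, for all $t>0$, $$c_0(t)=1,\qquad c_2(t)=-\frac{P_2(t)}{12(1+t)^3},\qquad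 c_4(t)=\frac{P_4(t)}{864(1+t)^6},$$ $$P_2(t)=2t^4-3t^3-20t^2-18t+2,$$ $$P_4(t)=4t^8-156t^7-695t^6-696t^5+1092t^4+2916t^3+1972t^2-72t+4.$$ -/

import Mathlib

open Filter

noncomputable section

namespace Touchard

/-- The Touchard (exponential) polynomial `T_n(x) = e^{-x} ∑_{k ≥ 0} k^n x^k / k!`
(with `0 ^ 0 = 1`; the series converges for every `x`). -/
def T (n : ℕ) (x : ℝ) : ℝ :=
  Real.exp (-x) * ∑' k : ℕ, (k : ℝ) ^ n * x ^ k / (Nat.factorial k : ℝ)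

/-- The phase function `ψ(t) = e^t / μ - log t`. -/
def psi (μ t : ℝ) : ℝ := Real.exp t / μ - Real.log t

/-- For the saddle point `t > 0` (so that `μ = t e^t`), the Taylor coefficients `a_r` in
`ψ(u) - ψ(t) = ∑_{r ≥ 0} a_r (u - t)^{r+2}`. -/
def a (t : ℝ) (r : ℕ) : ℝ :=
  iteratedDeriv (r + 2) (psi (t * Real.exp t)) t / (Nat.factorial (r + 2) : ℝ)

/-- Partial ordinary Bell polynomials: `bell b j k` is `B_{k,j}(b_1, …, b_{k-j+1})`, given by
`B_{k,0} = δ_{k,0}` and `B_{k,j} = ∑_{r=1}^{k-j+1} b_r B_{k-r,j-1}`. -/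
def bell (b : ℕ → ℝ) : ℕ → ℕ → ℝ
  | 0, k => if k = 0 then 1 else 0
  | j + 1, k => ∑ r ∈ Finset.Icc 1 (k - j), b r * bell b j (k - r)

/-- The coefficients: `coeff s t` is
`c_{2s}(t) = (-1)^s / a_0^s * ∑_{j=0}^{2s} (-1)^j (s + 1/2)_j / (j! a_0^j) * B_{2s,j}(a_1, a_2, …)`,
where `(α)_j = α (α + 1) ⋯ (α + j - 1)`. -/
def coeff (s : ℕ) (t : ℝ) : ℝ :=
  (-1) ^ s / a t 0 ^ s *
    ∑ j ∈ Finset.range (2 * s + 1),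
      (-1) ^ j * (ascPochhammer ℝ j).eval ((s : ℝ) + 1 / 2) /
        ((Nat.factorial j : ℝ) * a t 0 ^ j) * bell (a t) j (2 * s)

/-- `P_2(t)`. -/
def P2 (t : ℝ) : ℝ := 2 * t ^ 4 - 3 * t ^ 3 - 20 * t ^ 2 - 18 * t + 2

/-- `P_4(t)`. -/
def P4 (t : ℝ) : ℝ :=
  4 * t ^ 8 - 156 * t ^ 7 - 695 * t ^ 6 - 696 * t ^ 5 + 1092 * t ^ 4 + 2916 * t ^ 3
    + 1972 * t ^ 2 - 72 * t + 4

/-- The leading factor `Γ(n) e^{-x + n/t} / (√(2π(1+t)) t^{n-1})` (used for `n ≥ 1`). -/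
def leading (n : ℕ) (x t : ℝ) : ℝ :=
  Real.Gamma n * Real.exp (-x + n / t) /
    (Real.sqrt (2 * Real.pi * (1 + t)) * t ^ (n - 1))

/-- The `s`-th term `c_{2s}(t) Γ(s + 1/2) / (n^{s + 1/2} Γ(1/2))` of the series. -/
def term (n s : ℕ) (t : ℝ) : ℝ :=
  coeff s t * Real.Gamma ((s : ℝ) + 1 / 2) /
    ((n : ℝ) ^ ((s : ℝ) + 1 / 2) * Real.Gamma (1 / 2))

end Touchard

end

section

open MeasureTheory Complex Asymptotics

namespace Touchard

/-! Saddle-point method on a full vertical line. Fourier inversion of the Laplace transform of `u ^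
(n - 1)` writes `k ^ (n - 1) / (n - 1)!` as an integral of `e^{kz} / z^n` over `Re z = t`; summing
against `x ^ k / k!` gives an integral of `exp (x e^z) / z^n` for `T (n - 1) x` (`T_eq_integral`).
When `t e^t = n / x` the line meets the saddle `z = t`, and with `lam = n / t` and `z = t + v` the
integrand is a constant times `exp (lam * phase t v)`.

The phase has no linear term, and its Taylor coefficients `scaledCoeff t r = t * a t r` are bounded
uniformly for `t ≥ τ`, the quadratic one being at least `1 / 2`. Hence `lam` is the only large
parameter, which is why the error scale is `(t / n) ^ N`. Near `v = 0` the integrand is a Gaussian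
times a polynomial built from Bell polynomials, up to `lam ^ (-N)` times a wider Gaussian
(`exists_norm_exp_phase_sub_le`). The same bound holds for the approximation alone away from `0`
(`exists_norm_gaussApprox_le`), so it can be integrated over the whole line, where Gaussian moments
yield exactly the terms of the series (`re_integral_gaussApprox`).

Away from the saddle, `|exp (lam (e^{iy} - 1))| ≤ 1` and the powers of `|1 + iy/t|` give a factor
`exp (-c n / t²)` (`norm_cexp_phase_le`). Since `x ≥ δ` makes `t` at most logarithmic in `n`, this
beats every power of `n` (`exists_tail_le`). The condition `x ≤ C n` serves to keep `t` away from
`0`. -/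

/-! ### Laplace inversion and the integral representation -/

theorem integrableOn_pow_mul_exp_neg_mul (m : ℕ) {r : ℝ} (hr : 0 < r) :
    IntegrableOn (fun u : ℝ => u ^ m * Real.exp (-(r * u))) (Set.Ioi 0) := by
  have h := integrableOn_rpow_mul_exp_neg_mul_rpow (p := 1) (s := m) (b := r)
    (by have := Nat.cast_nonneg (α := ℝ) m; linarith) one_pos hr
  refine h.congr_fun (fun u _ => ?_) measurableSet_Ioi
  simp [Real.rpow_natCast]

theorem norm_pow_mul_cexp_neg_mul (m : ℕ) (z : ℂ) {u : ℝ} (hu : 0 < u) :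
    ‖(u : ℂ) ^ m * cexp (-(z * u))‖ = u ^ m * Real.exp (-(z.re * u)) := by
  rw [norm_mul, norm_pow, Complex.norm_real, Real.norm_of_nonneg hu.le, Complex.norm_exp]
  simp

theorem integrableOn_pow_mul_cexp_neg_mul (m : ℕ) {z : ℂ} (hz : 0 < z.re) :
    IntegrableOn (fun u : ℝ => (u : ℂ) ^ m * cexp (-(z * u))) (Set.Ioi 0) := by
  refine Integrable.mono' (integrableOn_pow_mul_exp_neg_mul m hz)
    (Continuous.aestronglyMeasurable (by fun_prop)) ?_
  filter_upwards [ae_restrict_mem measurableSet_Ioi] with u hu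
  exact (norm_pow_mul_cexp_neg_mul m z hu).le

/-- The Laplace transform of `u ^ m` on the right half-plane. -/
theorem integral_pow_mul_cexp_neg_mul (m : ℕ) {z : ℂ} (hz : 0 < z.re) :
    ∫ u in Set.Ioi (0 : ℝ), (u : ℂ) ^ m * cexp (-(z * u)) = (m.factorial : ℂ) / z ^ (m + 1) := by
  have hz0 : z ≠ 0 := fun h => by simp [h] at hz
  induction m with
  | zero =>
    have h := integral_exp_mul_complex_Ioi (a := -z) (by simpa using hz) 0
    simp only [neg_mul] at h
    simp [h, one_div]
  | succ m ih =>
    have hd : ∀ u : ℝ, HasDerivAt (fun u : ℝ => (u : ℂ) ^ (m + 1) * cexp (-(z * u)))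
        (((m : ℂ) + 1) * ((u : ℂ) ^ m * cexp (-(z * u)))
          - z * ((u : ℂ) ^ (m + 1) * cexp (-(z * u)))) u := by
      intro u
      have h1 : HasDerivAt (fun w : ℂ => w ^ (m + 1) * cexp (-(z * w)))
        (((m : ℂ) + 1) * ((u : ℂ) ^ m * cexp (-(z * u)))
          - z * ((u : ℂ) ^ (m + 1) * cexp (-(z * u)))) (u : ℂ) := by
        have h2 := (hasDerivAt_pow (m + 1) (u : ℂ)).mul
          (((hasDerivAt_id (u : ℂ)).const_mul z).neg.cexp)
        refine h2.congr_deriv ?_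
        simp; ring
      exact h1.comp_ofReal
    have hi1 := (integrableOn_pow_mul_cexp_neg_mul m hz).const_mul ((m : ℂ) + 1)
    have hi2 := (integrableOn_pow_mul_cexp_neg_mul (m + 1) hz).const_mul z
    have hlim : Tendsto (fun u : ℝ => (u : ℂ) ^ (m + 1) * cexp (-(z * u))) atTop (nhds 0) := by
      rw [tendsto_zero_iff_norm_tendsto_zero]
      have h := Real.tendsto_pow_mul_exp_neg_atTop_nhds_zero (m + 1)
      have h' := (h.comp (tendsto_id.const_mul_atTop hz)).const_mul ((z.re ^ (m + 1))⁻¹)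
      rw [mul_zero] at h'
      refine h'.congr' ?_
      filter_upwards [eventually_gt_atTop 0] with u hu
      rw [norm_pow_mul_cexp_neg_mul _ _ hu]
      simp only [Function.comp, id, mul_pow]
      have : z.re ^ (m + 1) ≠ 0 := by positivity
      field_simp
    have h := integral_Ioi_of_hasDerivAt_of_tendsto (a := (0 : ℝ)) (m := (0 : ℂ))
      (hd 0).continuousAt.continuousWithinAt (fun u _ => hd u) (hi1.sub hi2) hlim
    rw [integral_sub hi1 hi2, integral_const_mul, integral_const_mul, ih] at h
    simp only [ofReal_zero, ne_eq, Nat.add_eq_zero_iff, one_ne_zero, and_false,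
      not_false_eq_true, zero_pow, zero_mul, sub_zero, sub_eq_zero] at h
    rw [Nat.factorial_succ, pow_succ z (m + 1)]
    push_cast
    field_simp at h ⊢
    linear_combination -h

/-- Two of the `n` factors supply an integrable Cauchy-type majorant; the others are at least `t` in
modulus. -/
theorem one_add_sq_le_norm_pow {t : ℝ} (ht : 0 < t) (n : ℕ) (hn : 2 ≤ n) (y : ℝ) :
    t ^ n * (1 + (y / t) ^ 2) ≤ ‖((t : ℂ) + y * I) ^ n‖ := by
  have hsq : ‖(t : ℂ) + y * I‖ ^ 2 = t ^ 2 * (1 + (y / t) ^ 2) := by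
    rw [← Complex.normSq_eq_norm_sq, Complex.normSq_add_mul_I]; field_simp
  have hge : t ≤ ‖(t : ℂ) + y * I‖ := by
    have := Complex.re_le_norm ((t : ℂ) + y * I)
    simpa using this
  obtain ⟨k, rfl⟩ := Nat.exists_eq_add_of_le' hn
  rw [norm_pow, pow_add, pow_add, hsq]
  calc t ^ k * t ^ 2 * (1 + (y / t) ^ 2) = t ^ k * (t ^ 2 * (1 + (y / t) ^ 2)) := by ring
    _ ≤ _ := by gcongr

theorem add_mul_I_ne_zero {t : ℝ} (ht : 0 < t) (y : ℝ) : (t : ℂ) + y * I ≠ 0 := by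
  intro h
  have := congrArg Complex.re h
  simp at this
  exact ht.ne' this

theorem integrable_inv_one_add_div_sq {t : ℝ} (ht : 0 < t) :
    Integrable (fun y : ℝ => (1 + (y / t) ^ 2)⁻¹) :=
  integrable_inv_one_add_sq.comp_div ht.ne'

theorem norm_div_pow_le {t : ℝ} (ht : 0 < t) {n : ℕ} (hn : 2 ≤ n) {w : ℂ} {B : ℝ} (hw : ‖w‖ ≤ B)
    (y : ℝ) : ‖w / ((t : ℂ) + y * I) ^ n‖ ≤ B / t ^ n * (1 + (y / t) ^ 2)⁻¹ := by
  have h := one_add_sq_le_norm_pow ht n hn y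
  have hB : 0 ≤ B := (norm_nonneg w).trans hw
  rw [norm_div, div_mul_eq_mul_div, ← div_eq_mul_inv, div_div, mul_comm _ (t ^ n)]
  gcongr

theorem integrable_div_pow {t : ℝ} (ht : 0 < t) {n : ℕ} (hn : 2 ≤ n) {g : ℝ → ℂ}
    (hg : Continuous g) {B : ℝ} (hB : ∀ y, ‖g y‖ ≤ B) :
    Integrable (fun y : ℝ => g y / ((t : ℂ) + y * I) ^ n) := by
  refine Integrable.mono' ((integrable_inv_one_add_div_sq ht).const_mul (B / t ^ n))
    (Continuous.aestronglyMeasurable ?_) (ae_of_all _ fun y => norm_div_pow_le ht hn (hB y) y)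
  exact hg.div (by fun_prop) fun y => pow_ne_zero _ (add_mul_I_ne_zero ht y)

theorem norm_cexp_mul_add_mul_I (k t y : ℝ) :
    ‖cexp (k * ((t : ℂ) + y * I))‖ = Real.exp (k * t) := by
  rw [Complex.norm_exp]; simp

/-- Inverse Laplace transform of `z⁻ⁿ` along the line `Re z = t`. -/
theorem integral_cexp_div_pow {t : ℝ} (ht : 0 < t) {n : ℕ} (hn : 2 ≤ n) {k : ℝ} (hk : 0 ≤ k) :
    ∫ y : ℝ, cexp (k * ((t : ℂ) + y * I)) / ((t : ℂ) + y * I) ^ n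
      = 2 * Real.pi * (k : ℂ) ^ (n - 1) / ((n - 1).factorial : ℂ) := by
  obtain ⟨m, rfl⟩ : ∃ m, n = m + 1 := ⟨n - 1, by omega⟩
  have hm : m ≠ 0 := by omega
  -- Because `m ≥ 1`, cutting off with `max u 0` keeps `f` continuous at `0`, so inversion holds
  -- pointwise, even at `k = 0`.
  set f : ℝ → ℂ := fun u => ((max u 0 : ℝ) : ℂ) ^ m * cexp (-(t * u)) with hf
  have hfc : Continuous f := by fun_prop
  have hf0 : ∀ u ≤ 0, f u = 0 := fun u hu => by simp [hf, hu, hm]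
  have hf1 : ∀ u : ℝ, 0 < u → f u = (u : ℂ) ^ m * cexp (-(t * u)) := fun u hu => by
    simp [hf, max_eq_left hu.le]
  have hfi : Integrable f := by
    rw [← integrableOn_univ, ← Set.Iic_union_Ioi (a := (0 : ℝ))]
    refine IntegrableOn.union ?_ ?_
    · exact integrableOn_zero.congr_fun (fun u hu => (hf0 u hu).symm) measurableSet_Iic
    · exact (integrableOn_pow_mul_cexp_neg_mul m (z := t) (by simpa using ht)).congr_fun
        (fun u hu => (hf1 u hu).symm) measurableSet_Ioi
  have hF : ∀ w : ℝ, FourierTransform.fourier f w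
      = (m.factorial : ℂ) / ((t : ℂ) + (2 * Real.pi * w : ℝ) * I) ^ (m + 1) := by
    intro w
    rw [Real.fourier_real_eq_integral_exp_smul,
      ← integral_pow_mul_cexp_neg_mul m (z := (t : ℂ) + (2 * Real.pi * w : ℝ) * I)
        (by simpa using ht),
      ← setIntegral_eq_integral_of_forall_compl_eq_zero (s := Set.Ioi 0)]
    · refine setIntegral_congr_fun measurableSet_Ioi fun u hu => ?_
      simp only [hf1 u hu, smul_eq_mul]
      rw [mul_left_comm, ← Complex.exp_add]
      congr 2
      push_cast; ring
    · intro u hu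
      simp [hf0 u (not_lt.mp hu)]
  have hpi : (0 : ℝ) < 2 * Real.pi := by positivity
  have hFi : Integrable (FourierTransform.fourier f) := by
    have h := (integrable_div_pow ht hn (g := fun _ => (m.factorial : ℂ)) continuous_const
      (fun _ => le_rfl)).comp_mul_left' hpi.ne'
    exact h.congr (ae_of_all _ fun w => (hF w).symm)
  have hinv := congrFun (hfc.fourierInv_fourier_eq hfi hFi) k
  rw [Real.fourierInv_eq'] at hinv
  have hfk : f k = (k : ℂ) ^ m * cexp (-(t * k)) := by simp [hf, max_eq_left hk]
  have hsub := Measure.integral_comp_mul_left (fun y : ℝ =>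
    cexp (k * ((t : ℂ) + y * I)) / ((t : ℂ) + y * I) ^ (m + 1)) (2 * Real.pi)
  have heq : ∀ w : ℝ, cexp (k * ((t : ℂ) + (2 * Real.pi * w : ℝ) * I))
        / ((t : ℂ) + (2 * Real.pi * w : ℝ) * I) ^ (m + 1)
      = (cexp (k * t) / m.factorial) *
        (cexp (((2 * Real.pi * inner ℝ w k : ℝ) : ℂ) * I) • FourierTransform.fourier f w) := by
    intro w
    have : (m.factorial : ℂ) ≠ 0 := by exact_mod_cast m.factorial_ne_zero
    rw [hF, smul_eq_mul, mul_add, Complex.exp_add]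
    have h2 : (k : ℂ) * ((2 * Real.pi * w : ℝ) * I) = ((2 * Real.pi * inner ℝ w k : ℝ) : ℂ) * I := by
      simp; ring
    rw [h2]
    field_simp
  rw [integral_congr_ae (ae_of_all _ heq), integral_const_mul, hinv, hfk,
    abs_of_pos (inv_pos.mpr hpi)] at hsub
  have hexp : cexp (k * t) * cexp (-(t * k)) = 1 := by
    rw [← Complex.exp_add]; simp [mul_comm]
  rw [Nat.add_sub_cancel]
  have h3 : cexp (k * t) / m.factorial * ((k : ℂ) ^ m * cexp (-(t * k)))
      = (k : ℂ) ^ m / m.factorial := by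
    linear_combination (k : ℂ) ^ m / m.factorial * hexp
  rw [h3, Complex.real_smul] at hsub
  have hpi' : ((2 * Real.pi : ℝ) : ℂ) ≠ 0 := by exact_mod_cast hpi.ne'
  have h4 : (2 * Real.pi : ℂ) = ((2 * Real.pi : ℝ) : ℂ) := by push_cast; rfl
  rw [mul_div_assoc, hsub, h4, Complex.ofReal_inv, mul_inv_cancel_left₀ hpi']

/-- The Touchard polynomial as an integral along the line `Re z = t`. -/
theorem T_eq_integral {n : ℕ} (hn : 2 ≤ n) {x t : ℝ} (hx : 0 < x) (ht : 0 < t) :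
    (T (n - 1) x : ℂ) = (n - 1).factorial * Real.exp (-x) / (2 * Real.pi) *
      ∫ y : ℝ, cexp (x * cexp ((t : ℂ) + y * I)) / ((t : ℂ) + y * I) ^ n := by
  set F : ℕ → ℝ → ℂ := fun k y => ((x : ℂ) ^ k / k.factorial) *
    (cexp ((k : ℝ) * ((t : ℂ) + y * I)) / ((t : ℂ) + y * I) ^ n) with hFdef
  have hFi : ∀ k, Integrable (F k) := fun k =>
    (integrable_div_pow ht hn (by fun_prop)
      (fun y => (norm_cexp_mul_add_mul_I k t y).le)).const_mul _
  have hFs : ∀ y, HasSum (fun k => F k y)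
      (cexp (x * cexp ((t : ℂ) + y * I)) / ((t : ℂ) + y * I) ^ n) := by
    intro y
    have h := (NormedSpace.expSeries_div_hasSum_exp (𝔸 := ℂ) (x * cexp ((t : ℂ) + y * I)))
    rw [← Complex.exp_eq_exp_ℂ] at h
    refine (h.div_const (((t : ℂ) + y * I) ^ n)).congr_fun ?_
    intro k
    simp only [hFdef]
    rw [mul_pow, ← Complex.exp_nat_mul]
    push_cast
    ring
  -- Absolute convergence, dominated by the series of `exp (x e^t)`, justifies exchanging sum and
  -- integral.
  have hsum : Summable fun k => ∫ y, ‖F k y‖ := by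
    have hb : ∀ k, ∫ y, ‖F k y‖ ≤ (x * Real.exp t) ^ k / k.factorial *
        ((t ^ n)⁻¹ * ∫ y : ℝ, (1 + (y / t) ^ 2)⁻¹) := by
      intro k
      rw [← integral_const_mul, ← integral_const_mul]
      refine integral_mono (hFi k).norm (((integrable_inv_one_add_div_sq ht).const_mul _).const_mul _)
        fun y => ?_
      simp only [hFdef, norm_mul, norm_div, norm_pow, Complex.norm_real, Real.norm_of_nonneg hx.le,
        RCLike.norm_natCast]
      have h := norm_div_pow_le ht hn (norm_cexp_mul_add_mul_I k t y).le y
      rw [norm_div, norm_pow] at h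
      calc _ ≤ x ^ k / k.factorial * (Real.exp (k * t) / t ^ n * (1 + (y / t) ^ 2)⁻¹) := by
            gcongr
        _ = _ := by rw [mul_pow, ← Real.exp_nat_mul]; ring
    exact Summable.of_nonneg_of_le (fun k => integral_nonneg fun y => norm_nonneg _) hb
      ((Real.summable_pow_div_factorial _).mul_right _)
  have h := hasSum_integral_of_summable_integral_norm hFi hsum
  simp_rw [fun y => (hFs y).tsum_eq] at h
  rw [← h.tsum_eq]
  have hterm : ∀ k, ∫ y, F k y = ((2 * Real.pi / (n - 1).factorial : ℝ) : ℂ) *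
      (((k : ℝ) ^ (n - 1) * x ^ k / k.factorial : ℝ) : ℂ) := by
    intro k
    simp only [hFdef]
    rw [integral_const_mul, integral_cexp_div_pow ht hn (Nat.cast_nonneg k)]
    push_cast; ring
  simp_rw [hterm]
  rw [tsum_mul_left, ← Complex.ofReal_tsum, T]
  have h1 : ((n - 1).factorial : ℂ) ≠ 0 := by exact_mod_cast (n - 1).factorial_ne_zero
  have h2 : (Real.pi : ℂ) ≠ 0 := by exact_mod_cast Real.pi_ne_zero
  push_cast
  field_simp

/-! ### Taylor coefficients at the saddle and Bell polynomials -/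

/-- The Taylor coefficients of `(e^w - 1) - t log (1 + w / t)`, which are `t * a t r`. -/
noncomputable def scaledCoeff (t : ℝ) (r : ℕ) : ℝ :=
  1 / (r + 2).factorial + (-1) ^ r / ((r + 2 : ℕ) * t ^ (r + 1))

theorem a_eq_scaledCoeff_div {t : ℝ} (ht : 0 < t) (r : ℕ) : a t r = scaledCoeff t r / t := by
  have hexp : iteratedDeriv (r + 2) (fun u => (t * Real.exp t)⁻¹ * Real.exp u) t
      = (t * Real.exp t)⁻¹ * Real.exp t := by
    rw [iteratedDeriv_const_mul _ Real.contDiff_exp.contDiffAt, iteratedDeriv_eq_iterate,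
      Real.iter_deriv_exp]
  have hlog : iteratedDeriv (r + 2) Real.log t
      = (-1) ^ (r + 1) * (r + 1).factorial * t ^ (-1 - ((r + 1 : ℕ) : ℤ)) := by
    rw [iteratedDeriv_succ', Real.deriv_log', iteratedDeriv_eq_iterate]
    exact iter_deriv_inv (r + 1) t
  have hpsi : psi (t * Real.exp t)
      = fun u => (t * Real.exp t)⁻¹ * Real.exp u - Real.log u := by
    funext u; rw [psi]; ring
  rw [a, hpsi, iteratedDeriv_fun_sub (contDiff_const.mul Real.contDiff_exp).contDiffAt
    (Real.contDiffAt_log.mpr ht.ne'), hexp, hlog, scaledCoeff]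
  have hz : t ^ (-1 - ((r + 1 : ℕ) : ℤ)) = (t ^ (r + 2))⁻¹ := by
    rw [← zpow_natCast, ← zpow_neg]; congr 1; push_cast; ring
  rw [hz, Nat.factorial_succ (r + 1)]
  have h1 : ((r + 1).factorial : ℝ) ≠ 0 := by positivity
  have h2 := (Real.exp_pos t).ne'
  have h3 : ((r + 1 + 1 : ℕ) : ℝ) ≠ 0 := by positivity
  push_cast at h3 ⊢
  field_simp
  ring

theorem scaledCoeff_zero (t : ℝ) : scaledCoeff t 0 = 1 / 2 + 1 / (2 * t) := by
  simp [scaledCoeff]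

theorem half_le_scaledCoeff_zero {t : ℝ} (ht : 0 < t) : 1 / 2 ≤ scaledCoeff t 0 := by
  rw [scaledCoeff_zero]
  have : 0 < 1 / (2 * t) := by positivity
  linarith

theorem abs_scaledCoeff_le {τ t : ℝ} (hτ : 0 < τ) (ht : τ ≤ t) (r : ℕ) :
    |scaledCoeff t r| ≤ 1 + 1 / τ ^ (r + 1) := by
  have ht0 : 0 < t := hτ.trans_le ht
  refine (abs_add_le _ _).trans (add_le_add ?_ ?_)
  · rw [abs_of_nonneg (by positivity), div_le_one (by positivity)]
    exact_mod_cast Nat.one_le_iff_ne_zero.mpr (Nat.factorial_ne_zero _)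
  · rw [abs_div, abs_pow, abs_neg, abs_one, one_pow, abs_of_nonneg (by positivity)]
    have h1 : (1 : ℝ) ≤ (r + 2 : ℕ) := by push_cast; linarith [Nat.cast_nonneg (α := ℝ) r]
    have h2 : τ ^ (r + 1) ≤ t ^ (r + 1) := by gcongr
    refine one_div_le_one_div_of_le (by positivity) (h2.trans ?_)
    nlinarith [pow_pos ht0 (r + 1)]

theorem bell_eq_zero_of_lt (b : ℕ → ℝ) {j k : ℕ} (h : k < j) : bell b j k = 0 := by
  obtain ⟨i, rfl⟩ : ∃ i, j = i + 1 := ⟨j - 1, by omega⟩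
  have : Finset.Icc 1 (k - i) = ∅ := by
    rw [Finset.Icc_eq_empty_iff]; omega
  rw [bell, this, Finset.sum_empty]

/-- Puts the recursion in the form of a full Cauchy product with a series without constant term; the
added summands vanish. -/
theorem bell_succ (b : ℕ → ℝ) (j k : ℕ) :
    bell b (j + 1) k
      = ∑ r ∈ Finset.range (k + 1), (if r = 0 then 0 else b r) * bell b j (k - r) := by
  rw [bell]
  refine Finset.sum_subset_zero_on_sdiff ?_ ?_ ?_
  · intro r hr
    simp only [Finset.mem_Icc, Finset.mem_range] at hr ⊢
    omega
  · intro r hr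
    simp only [Finset.mem_sdiff, Finset.mem_Icc, Finset.mem_range] at hr
    split_ifs with h0
    · simp
    · rw [bell_eq_zero_of_lt b (by omega), mul_zero]
  · intro r hr
    simp only [Finset.mem_Icc] at hr
    rw [if_neg (by omega)]

theorem bell_div (b : ℕ → ℝ) (c : ℝ) (j k : ℕ) :
    bell (fun r => b r / c) j k = bell b j k / c ^ j := by
  induction j generalizing k with
  | zero => simp [bell]
  | succ j ih =>
    simp only [bell, ih, Finset.sum_div]
    refine Finset.sum_congr rfl fun r _ => ?_
    rw [pow_succ, div_mul_div_comm, mul_comm c]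

theorem bell_congr {b b' : ℕ → ℝ} (h : ∀ r, b r = b' r) (j k : ℕ) : bell b j k = bell b' j k := by
  rw [funext h]

/-- By homogeneity of the Bell polynomials the powers `t ^ j` cancel inside the sum. The surviving
`t ^ s` combines with `n ^ (-s)` into a power of `lam = n / t`. -/
theorem coeff_eq_scaledCoeff {t : ℝ} (ht : 0 < t) (s : ℕ) :
    coeff s t = t ^ s * ((-1) ^ s / scaledCoeff t 0 ^ s *
      ∑ j ∈ Finset.range (2 * s + 1),
        (-1) ^ j * (ascPochhammer ℝ j).eval ((s : ℝ) + 1 / 2) /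
          ((Nat.factorial j : ℝ) * scaledCoeff t 0 ^ j) * bell (scaledCoeff t) j (2 * s)) := by
  have h0 : scaledCoeff t 0 ≠ 0 := by have := half_le_scaledCoeff_zero ht; positivity
  rw [coeff, ← mul_assoc]
  congr 1
  · rw [a_eq_scaledCoeff_div ht, div_pow]; field_simp
  · refine Finset.sum_congr rfl fun j _ => ?_
    rw [bell_congr (a_eq_scaledCoeff_div ht), bell_div, a_eq_scaledCoeff_div ht, div_pow]
    field_simp

theorem coeff_zero (t : ℝ) : coeff 0 t = 1 := by
  simp [coeff, bell]

theorem coeff_one {t : ℝ} (ht : 0 < t) : coeff 1 t = -P2 t / (12 * (1 + t) ^ 3) := by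
  have h1 : 1 + t ≠ 0 := by positivity
  rw [coeff_eq_scaledCoeff ht]
  simp [Finset.sum_range_succ, bell, Finset.sum_Icc_succ_top, ascPochhammer_succ_eval, P2,
    Nat.factorial]
  rw [scaledCoeff_zero, scaledCoeff, scaledCoeff]
  have h0 : (1 / 2 + 1 / (2 * t)) = (1 + t) / (2 * t) := by field_simp; ring
  rw [h0]
  norm_num [Nat.factorial]
  field_simp
  ring

theorem coeff_two {t : ℝ} (ht : 0 < t) : coeff 2 t = P4 t / (864 * (1 + t) ^ 6) := by
  have h1 : 1 + t ≠ 0 := by positivity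
  rw [coeff_eq_scaledCoeff ht]
  simp [Finset.sum_range_succ, bell, Finset.sum_Icc_succ_top, ascPochhammer_succ_eval, P4,
    Nat.factorial]
  rw [scaledCoeff_zero, scaledCoeff, scaledCoeff, scaledCoeff, scaledCoeff]
  have h0 : (1 / 2 + 1 / (2 * t)) = (1 + t) / (2 * t) := by field_simp; ring
  rw [h0]
  norm_num [Nat.factorial]
  field_simp
  ring

/-! ### Existence and uniqueness of the saddle point -/

theorem mul_exp_strictMonoOn : StrictMonoOn (fun t : ℝ => t * Real.exp t) (Set.Ici 0) := by
  intro s hs t _ hst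
  have hs' : 0 ≤ s := hs
  have := Real.exp_pos s
  have h2 : Real.exp s < Real.exp t := Real.exp_lt_exp.mpr hst
  change s * Real.exp s < t * Real.exp t
  nlinarith

theorem existsUnique_mul_exp_eq {μ : ℝ} (hμ : 0 < μ) : ∃! t : ℝ, 0 < t ∧ t * Real.exp t = μ := by
  have hc : ContinuousOn (fun t : ℝ => t * Real.exp t) (Set.Icc 0 μ) := by fun_prop
  have hmem : μ ∈ Set.Icc (0 * Real.exp 0) (μ * Real.exp μ) := by
    refine ⟨by simpa using hμ.le, ?_⟩
    nlinarith [Real.one_le_exp hμ.le]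
  obtain ⟨t, ht, hte⟩ := intermediate_value_Icc hμ.le hc hmem
  have hte' : t * Real.exp t = μ := hte
  have ht0 : 0 < t := by
    rcases ht.1.eq_or_lt with h | h
    · rw [← h, zero_mul] at hte'; exact absurd hte' hμ.ne
    · exact h
  refine ⟨t, ⟨ht0, hte'⟩, fun s hs => ?_⟩
  exact mul_exp_strictMonoOn.injOn hs.1.le ht0.le (hs.2.trans hte'.symm)

/-! ### Truncated power series with uniform errors -/

section Truncation

theorem isBigO_one_mul {α : Type*} {l : Filter α} {f g h : α → ℂ}
    (hf : f =O[l] fun _ => (1 : ℝ)) (hg : g =O[l] h) : (fun x => f x * g x) =O[l] h := by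
  have := hf.mul hg.norm_right
  simpa using this

/-- The difference consists of the products with `i + k ≥ M`, each a bounded factor times `v ^ M`.
-/
theorem sum_mul_sum_sub_isBigO {α : Type*} {l : Filter α} {v : α → ℂ}
    (hv : v =O[l] fun _ => (1 : ℝ)) {A B : ℕ → α → ℂ}
    (hA : ∀ i, A i =O[l] fun _ => (1 : ℝ)) (hB : ∀ i, B i =O[l] fun _ => (1 : ℝ)) (M : ℕ) :
    (fun x => (∑ i ∈ Finset.range M, A i x * v x ^ i) * (∑ k ∈ Finset.range M, B k x * v x ^ k)
      - ∑ m ∈ Finset.range M, (∑ i ∈ Finset.range (m + 1), A i x * B (m - i) x) * v x ^ m)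
      =O[l] fun x => v x ^ M := by
  have heq : ∀ x, (∑ i ∈ Finset.range M, A i x * v x ^ i)
        * (∑ k ∈ Finset.range M, B k x * v x ^ k)
      - ∑ m ∈ Finset.range M, (∑ i ∈ Finset.range (m + 1), A i x * B (m - i) x) * v x ^ m
      = ∑ i ∈ Finset.range M, ∑ k ∈ Finset.range M \ Finset.range (M - i),
          (A i x * v x ^ i) * (B k x * v x ^ k) := by
    intro x
    have h1 : ∑ m ∈ Finset.range M, (∑ i ∈ Finset.range (m + 1), A i x * B (m - i) x) * v x ^ m
        = ∑ i ∈ Finset.range M, ∑ k ∈ Finset.range (M - i),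
          (A i x * v x ^ i) * (B k x * v x ^ k) := by
      rw [← Finset.sum_range_diag_flip M fun i k => (A i x * v x ^ i) * (B k x * v x ^ k)]
      refine Finset.sum_congr rfl fun m _ => ?_
      rw [Finset.sum_mul]
      refine Finset.sum_congr rfl fun i hi => ?_
      have : v x ^ m = v x ^ i * v x ^ (m - i) := by
        rw [← pow_add]; congr 1; have := Finset.mem_range.mp hi; omega
      rw [this]; ring
    rw [h1, Finset.sum_mul_sum, ← Finset.sum_sub_distrib]
    refine Finset.sum_congr rfl fun i _ => ?_
    rw [Finset.sum_sdiff_eq_sub (Finset.range_subset_range.mpr (Nat.sub_le M i))]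
  simp_rw [heq]
  refine .fun_sum fun i _ => .fun_sum fun k hk => ?_
  simp only [Finset.mem_sdiff, Finset.mem_range] at hk
  obtain ⟨d, hd⟩ : ∃ d, i + k = d + M := ⟨i + k - M, by omega⟩
  have hrew : ∀ x, (A i x * v x ^ i) * (B k x * v x ^ k)
      = (A i x * B k x * v x ^ d) * v x ^ M := fun x => by
    calc _ = A i x * B k x * (v x ^ (i + k)) := by ring
      _ = _ := by rw [hd]; ring
  simp_rw [hrew]
  have h := ((hA i).mul (hB k)).mul (hv.pow d)
  simp only [one_pow, mul_one] at h
  exact isBigO_one_mul h (isBigO_refl _ l)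

theorem bell_isBigO_one {α : Type*} {l : Filter α} {b : α → ℕ → ℝ}
    (hb : ∀ r, (fun x => b x r) =O[l] fun _ => (1 : ℝ)) (j k : ℕ) :
    (fun x => bell (b x) j k) =O[l] fun _ => (1 : ℝ) := by
  induction j generalizing k with
  | zero =>
    simp only [bell]
    exact isBigO_const_const _ one_ne_zero _
  | succ j ih =>
    simp only [bell]
    refine .fun_sum fun r _ => ?_
    simpa using (hb r).mul (ih (k - r))

theorem ofReal_isBigO_one {α : Type*} {l : Filter α} {f : α → ℝ}
    (hf : f =O[l] fun _ => (1 : ℝ)) : (fun x => (f x : ℂ)) =O[l] fun _ => (1 : ℝ) :=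
  IsBigO.of_norm_left (by simpa using hf.norm_left)

/-- `bell b j` lists the coefficients of the `j`-th power of `∑ r ≥ 1, b r * v ^ r`. -/
theorem pow_sub_sum_bell_isBigO {α : Type*} {l : Filter α} {v : α → ℂ}
    (hv : v =O[l] fun _ => (1 : ℝ)) {b : α → ℕ → ℝ}
    (hb : ∀ r, (fun x => b x r) =O[l] fun _ => (1 : ℝ)) (M j : ℕ) :
    (fun x => (∑ r ∈ Finset.range M, ((if r = 0 then 0 else b x r : ℝ) : ℂ) * v x ^ r) ^ j
      - ∑ k ∈ Finset.range M, (bell (b x) j k : ℂ) * v x ^ k) =O[l] fun x => v x ^ M := by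
  have hA : ∀ r, (fun x => ((if r = 0 then 0 else b x r : ℝ) : ℂ)) =O[l] fun _ => (1 : ℝ) := by
    intro r
    refine ofReal_isBigO_one ?_
    split_ifs
    · exact isBigO_const_const _ one_ne_zero _
    · exact hb r
  have hB : ∀ j k, (fun x => (bell (b x) j k : ℂ)) =O[l] fun _ => (1 : ℝ) :=
    fun j k => ofReal_isBigO_one (bell_isBigO_one hb j k)
  have hp : (fun x => ∑ r ∈ Finset.range M, ((if r = 0 then 0 else b x r : ℝ) : ℂ) * v x ^ r)
      =O[l] fun _ => (1 : ℝ) := by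
    refine .fun_sum fun r _ => ?_
    simpa using (hA r).mul (hv.pow r)
  induction j with
  | zero =>
    rcases M with _ | M
    · simpa using isBigO_refl (fun _ : α => (1 : ℂ)) l
    · exact (isBigO_zero (E' := ℂ) _ l).congr_left fun x => by simp [bell, Finset.sum_range_succ']
  | succ j ih =>
    have h2 := sum_mul_sum_sub_isBigO hv hA (hB j) M
    have h1 := isBigO_one_mul hp ih
    refine (h1.add h2).congr_left fun x => ?_
    have h3 : ∀ m, (bell (b x) (j + 1) m : ℂ) = ∑ i ∈ Finset.range (m + 1),
        ((if i = 0 then 0 else b x i : ℝ) : ℂ) * (bell (b x) j (m - i) : ℂ) := by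
      intro m; rw [bell_succ]; push_cast; rfl
    simp_rw [h3]
    ring

/-- Induction on `A ^ (j+1) - B ^ (j+1) = A (A ^ j - B ^ j) + (A - B) B ^ j`. -/
theorem pow_sub_pow_isBigO {α : Type*} {l : Filter α} {A B g h : α → ℂ}
    (hA : A =O[l] g) (hB : B =O[l] g) (hAB : (fun x => A x - B x) =O[l] fun x => g x * h x)
    (j : ℕ) :
    (fun x => A x ^ j - B x ^ j) =O[l] fun x => g x ^ j * h x := by
  induction j with
  | zero => simpa using isBigO_zero (E' := ℂ) h l
  | succ j ih =>
    have h1 := hA.mul ih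
    have h2 := hAB.mul (hB.pow j)
    refine ((h1.congr_right fun x => ?_).add (h2.congr_right (g₂ := fun x => g x ^ (j + 1) * h x)
      fun x => ?_)).congr_left fun x => ?_
    all_goals ring

end Truncation

/-! ### The rescaled phase and Gaussian absorption -/

section Phase

/-- `h(v) = e^v - 1 - t log (1 + v / t)`, the rescaled phase at the saddle point. -/
noncomputable def phase (t : ℝ) (v : ℂ) : ℂ := cexp v - 1 - t * log (1 + v / t)

/-- The linear terms of `e^v` and of `t log (1 + v / t)` cancel, which is the saddle condition. The
remainders of the two series then add up, with a constant depending on `τ` and `M` only. -/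
theorem norm_phase_sub_sum_le {τ t : ℝ} (hτ : 0 < τ) (ht : τ ≤ t) {v : ℂ} (hv1 : ‖v‖ ≤ 1)
    (hv2 : ‖v‖ ≤ τ / 2) (M : ℕ) :
    ‖phase t v - ∑ r ∈ Finset.range M, (scaledCoeff t r : ℂ) * v ^ (r + 2)‖
      ≤ (Real.exp 1 + 2 / τ ^ (M + 1)) * ‖v‖ ^ (M + 2) := by
  have ht0 : 0 < t := hτ.trans_le ht
  have htC : (t : ℂ) ≠ 0 := by exact_mod_cast ht0.ne'
  have hz : ‖v / t‖ ≤ 1 / 2 := by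
    rw [norm_div, Complex.norm_real, Real.norm_of_nonneg ht0.le, div_le_iff₀ ht0]
    linarith
  have hid : phase t v - ∑ r ∈ Finset.range M, (scaledCoeff t r : ℂ) * v ^ (r + 2)
      = (cexp v - ∑ m ∈ Finset.range (M + 2), v ^ m / m.factorial)
        - t * (log (1 + v / t) - logTaylor (M + 1 + 1) (v / t)) := by
    rw [phase, logTaylor, Finset.sum_range_succ', Finset.sum_range_succ', Finset.sum_range_succ',
      Finset.sum_range_succ']
    have hsum : ∑ r ∈ Finset.range M, (scaledCoeff t r : ℂ) * v ^ (r + 2)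
        = ∑ r ∈ Finset.range M, v ^ (r + 1 + 1) / ((r + 1 + 1).factorial : ℂ)
          - t * ∑ r ∈ Finset.range M, (-1) ^ (r + 1 + 1 + 1) * (v / t) ^ (r + 1 + 1)
            / ((r + 1 + 1 : ℕ) : ℂ) := by
      rw [Finset.mul_sum, ← Finset.sum_sub_distrib]
      refine Finset.sum_congr rfl fun r _ => ?_
      have h3 : ((r + 2 : ℕ) : ℂ) ≠ 0 := by exact_mod_cast (by omega : r + 2 ≠ 0)
      have h4 : ((r + 2).factorial : ℂ) ≠ 0 := by exact_mod_cast (r + 2).factorial_ne_zero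
      have h5 : t * ((-1) ^ (r + 1 + 1 + 1) * (v / t) ^ (r + 1 + 1) / ((r + 1 + 1 : ℕ) : ℂ))
          = - ((-1) ^ r * v ^ (r + 2) / (((r + 2 : ℕ) : ℂ) * t ^ (r + 1))) := by
        rw [div_pow, pow_succ (t : ℂ) (r + 1)]
        field_simp
        ring
      rw [scaledCoeff, h5]
      push_cast
      ring
    rw [hsum]
    simp
    field_simp
    ring
  rw [hid]
  refine (norm_sub_le _ _).trans ?_
  rw [add_mul]
  refine add_le_add ?_ ?_
  · refine (Complex.norm_exp_sub_sum_le_norm_mul_exp v (M + 2)).trans ?_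
    rw [mul_comm]
    gcongr
  · rw [norm_mul, Complex.norm_real, Real.norm_of_nonneg ht0.le]
    have h := Complex.norm_log_sub_logTaylor_le (M + 1) (z := v / t) (by linarith)
    have h5 : (1 - ‖v / t‖)⁻¹ ≤ 2 := by
      rw [inv_le_comm₀ (by linarith) (by norm_num)]; linarith
    have h6 : ‖v / t‖ ^ (M + 1 + 1) * (1 - ‖v / t‖)⁻¹ / (((M + 1 : ℕ) : ℝ) + 1)
        ≤ ‖v / t‖ ^ (M + 1 + 1) * 2 := by
      refine (div_le_self (mul_nonneg (by positivity) (inv_nonneg.mpr (by linarith))) ?_).trans ?_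
      · have := Nat.cast_nonneg (α := ℝ) (M + 1); linarith
      · gcongr
    calc t * ‖log (1 + v / t) - logTaylor (M + 1 + 1) (v / t)‖
        ≤ t * (‖v / t‖ ^ (M + 1 + 1) * 2) := by gcongr; exact h.trans h6
      _ = 2 / t ^ (M + 1) * ‖v‖ ^ (M + 2) := by
        rw [norm_div, Complex.norm_real, Real.norm_of_nonneg ht0.le, div_pow, pow_succ t (M + 1)]
        field_simp
      _ ≤ _ := by gcongr

/-- Apply `u ^ m ≤ m! e^u` with `u = lam y² / 8`: half of the exponent pays for the powers, and the
excess factor `y ^ (2N)` becomes `lam ^ (-N)`. -/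
theorem pow_mul_abs_pow_mul_exp_le (i N : ℕ) {lam : ℝ} (hl : 0 < lam) (y : ℝ) :
    lam ^ i * |y| ^ (2 * (i + N)) * Real.exp (-(lam * y ^ 2 / 4))
      ≤ (8 ^ (i + N) * (i + N).factorial) *
        ((lam ^ N)⁻¹ * Real.exp (-(lam * y ^ 2 / 8))) := by
  have hu : 0 ≤ lam * y ^ 2 / 8 := by positivity
  have h := Real.pow_div_factorial_le_exp _ hu (i + N)
  have hf : (0 : ℝ) < (i + N).factorial := by positivity
  rw [div_le_iff₀ hf] at h
  have hsplit : Real.exp (-(lam * y ^ 2 / 4))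
      = Real.exp (-(lam * y ^ 2 / 8)) * Real.exp (-(lam * y ^ 2 / 8)) := by
    rw [← Real.exp_add]; ring_nf
  have hone : Real.exp (lam * y ^ 2 / 8) * Real.exp (-(lam * y ^ 2 / 8)) = 1 := by
    rw [← Real.exp_add]; simp
  have hpow : lam ^ i * |y| ^ (2 * (i + N))
      = (lam ^ N)⁻¹ * 8 ^ (i + N) * (lam * y ^ 2 / 8) ^ (i + N) := by
    rw [pow_mul, sq_abs, div_pow, mul_pow, pow_add lam]
    field_simp
  rw [hpow, hsplit]
  calc _ ≤ (lam ^ N)⁻¹ * 8 ^ (i + N) * (Real.exp (lam * y ^ 2 / 8) * (i + N).factorial) *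
        (Real.exp (-(lam * y ^ 2 / 8)) * Real.exp (-(lam * y ^ 2 / 8))) := by gcongr
    _ = (8 ^ (i + N) * (i + N).factorial) * ((lam ^ N)⁻¹ * Real.exp (-(lam * y ^ 2 / 8))) *
        (Real.exp (lam * y ^ 2 / 8) * Real.exp (-(lam * y ^ 2 / 8))) := by ring
    _ = _ := by rw [hone, mul_one]

end Phase

/-! ### Uniform Gaussian approximation of the integrand -/

section LocalExpansion

/-- The Gaussian times the truncated expansion of `exp (lam * (phase t (i y) + b₀ y²))`. -/
noncomputable def gaussApprox (N : ℕ) (t lam y : ℝ) : ℂ :=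
  Real.exp (-(lam * scaledCoeff t 0 * y ^ 2)) *
    ∑ j ∈ Finset.range (2 * N), (lam : ℂ) ^ j / j.factorial * ((y * I) ^ 2) ^ j *
      ∑ k ∈ Finset.range (2 * N), (bell (scaledCoeff t) j k : ℂ) * (y * I) ^ k

theorem exp_neg_mul_scaledCoeff_le {t lam : ℝ} (ht : 0 < t) (hl : 0 < lam) (y : ℝ) :
    Real.exp (-(lam * scaledCoeff t 0 * y ^ 2)) ≤ Real.exp (-(lam * y ^ 2 / 4)) := by
  have h := half_le_scaledCoeff_zero ht
  have h2 : 0 ≤ lam * y ^ 2 := by positivity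
  refine Real.exp_le_exp.mpr (neg_le_neg ?_)
  nlinarith

theorem norm_ofReal_mul_I (y : ℝ) : ‖(y : ℂ) * I‖ = |y| := by simp

/-- The remainder scale. -/
noncomputable def gaussScale (N : ℕ) (lam y : ℝ) : ℝ :=
  (lam ^ N)⁻¹ * Real.exp (-(lam * y ^ 2 / 8))

/-- Uniformity in `(t, lam, y)` is expressed as `IsBigO` along the principal filter of the parameter
set, so the truncation lemmas apply. Each `j` leaves an error `lam ^ j |y| ^ (2j + 2N)` times a
Gaussian, which is then absorbed. -/
theorem exists_local_remainder_bound {τ : ℝ} (hτ : 0 < τ) (N : ℕ) {ε : ℝ} (hε1 : ε ≤ 1)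
    (hε2 : ε ≤ τ / 2) :
    ∃ K, ∀ p : ℝ × ℝ × ℝ, p ∈ {p : ℝ × ℝ × ℝ | τ ≤ p.1 ∧ 0 < p.2.1 ∧ |p.2.2| ≤ ε} →
      ‖Real.exp (-(p.2.1 * scaledCoeff p.1 0 * p.2.2 ^ 2)) * ∑ j ∈ Finset.range (2 * N),
          (p.2.1 * (phase p.1 (p.2.2 * I) - scaledCoeff p.1 0 * (p.2.2 * I) ^ 2)) ^ j / j.factorial
        - gaussApprox N p.1 p.2.1 p.2.2‖ ≤ K * ‖gaussScale N p.2.1 p.2.2‖ := by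
  set S := {p : ℝ × ℝ × ℝ | τ ≤ p.1 ∧ 0 < p.2.1 ∧ |p.2.2| ≤ ε} with hS
  rw [← isBigO_principal]
  set v : ℝ × ℝ × ℝ → ℂ := fun p => p.2.2 * I with hvdef
  have hv : v =O[𝓟 S] fun _ => (1 : ℝ) := by
    rw [isBigO_principal]
    refine ⟨1, fun p hp => ?_⟩
    simp only [hvdef, norm_ofReal_mul_I, norm_one, mul_one]
    exact hp.2.2.trans hε1
  have hb : ∀ r, (fun p : ℝ × ℝ × ℝ => scaledCoeff p.1 r) =O[𝓟 S] fun _ => (1 : ℝ) := by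
    intro r
    rw [isBigO_principal]
    refine ⟨1 + 1 / τ ^ (r + 1), fun p hp => ?_⟩
    simpa using abs_scaledCoeff_le hτ hp.1 r
  set D : ℝ × ℝ × ℝ → ℂ := fun p => phase p.1 (v p) - scaledCoeff p.1 0 * v p ^ 2 with hD
  have hphase : ∀ M, (fun p => phase p.1 (v p)
      - ∑ r ∈ Finset.range M, (scaledCoeff p.1 r : ℂ) * v p ^ (r + 2)) =O[𝓟 S]
        fun p => v p ^ (M + 2) := by
    intro M
    rw [isBigO_principal]
    refine ⟨Real.exp 1 + 2 / τ ^ (M + 1), fun p hp => ?_⟩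
    rw [norm_pow]
    have h : ‖v p‖ ≤ ε := by simpa only [hvdef, norm_ofReal_mul_I] using hp.2.2
    exact norm_phase_sub_sum_le hτ hp.1 (h.trans hε1) (h.trans hε2) M
  have hterm : ∀ j ∈ Finset.range (2 * N), (fun p : ℝ × ℝ × ℝ =>
      (Real.exp (-(p.2.1 * scaledCoeff p.1 0 * p.2.2 ^ 2)) * ((p.2.1 : ℂ) ^ j / j.factorial)) *
      (D p ^ j - (v p ^ 2) ^ j * ∑ k ∈ Finset.range (2 * N),
        (bell (scaledCoeff p.1) j k : ℂ) * v p ^ k)) =O[𝓟 S]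
      fun p => gaussScale N p.2.1 p.2.2 := by
    intro j hj
    have hN : 2 * N ≠ 0 := by have := Finset.mem_range.mp hj; omega
    obtain ⟨M, hM⟩ := Nat.exists_eq_succ_of_ne_zero hN
    set P : ℝ × ℝ × ℝ → ℂ := fun p => ∑ r ∈ Finset.range (2 * N),
      ((if r = 0 then 0 else scaledCoeff p.1 r : ℝ) : ℂ) * v p ^ r with hP
    have hPO : P =O[𝓟 S] fun _ => (1 : ℝ) := by
      refine .fun_sum fun r _ => ?_
      have h1 : (fun p : ℝ × ℝ × ℝ => ((if r = 0 then 0 else scaledCoeff p.1 r : ℝ) : ℂ))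
          =O[𝓟 S] fun _ => (1 : ℝ) := by
        refine ofReal_isBigO_one ?_
        split_ifs
        · exact isBigO_const_const _ one_ne_zero _
        · exact hb r
      simpa using h1.mul (hv.pow r)
    have hDO : D =O[𝓟 S] fun p => v p ^ 2 := by
      have h1 := hphase 1
      simp only [Finset.sum_range_one, zero_add] at h1
      refine h1.trans ?_
      refine (isBigO_one_mul hv (isBigO_refl (fun p => v p ^ 2) _)).congr_left fun p => ?_
      ring
    have hBO : (fun p => v p ^ 2 * P p) =O[𝓟 S] fun p => v p ^ 2 :=
      (isBigO_one_mul hPO (isBigO_refl (fun p => v p ^ 2) _)).congr_left fun p => mul_comm _ _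
    -- `D` already lacks the quadratic term, matching the zero constant term of `P`.
    have hDB : (fun p => D p - v p ^ 2 * P p) =O[𝓟 S] fun p => v p ^ 2 * v p ^ (2 * N) := by
      refine ((hphase (2 * N)).congr_left fun p => ?_).congr_right fun p => ?_
      · simp only [hD, hP, hM]
        rw [Finset.sum_range_succ', Finset.sum_range_succ', mul_add, Finset.mul_sum]
        have h2 : ∀ r, v p ^ 2 * (((if r + 1 = 0 then 0 else scaledCoeff p.1 (r + 1) : ℝ) : ℂ)
            * v p ^ (r + 1)) = (scaledCoeff p.1 (r + 1) : ℂ) * v p ^ (r + 1 + 2) := by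
          intro r; simp; ring
        simp only [h2]
        simp; ring
      · ring
    have h1 := pow_sub_pow_isBigO hDO hBO hDB j
    have h2 := (isBigO_refl (fun p => (v p ^ 2) ^ j) (𝓟 S)).mul
      (pow_sub_sum_bell_isBigO hv hb (2 * N) j)
    have h3 := (isBigO_refl (fun p : ℝ × ℝ × ℝ =>
      (Real.exp (-(p.2.1 * scaledCoeff p.1 0 * p.2.2 ^ 2)) : ℂ) * ((p.2.1 : ℂ) ^ j / j.factorial))
      (𝓟 S)).mul ((h1.add h2).congr_left (f₂ := fun p => D p ^ j - (v p ^ 2) ^ j *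
        ∑ k ∈ Finset.range (2 * N), (bell (scaledCoeff p.1) j k : ℂ) * v p ^ k)
        fun p => by simp only [hP, mul_pow]; ring)
    refine h3.trans ?_
    rw [isBigO_principal]
    refine ⟨8 ^ (j + N) * (j + N).factorial, fun p hp => ?_⟩
    have hl := hp.2.1
    rw [gaussScale, Real.norm_of_nonneg (by positivity)]
    refine le_trans ?_ (pow_mul_abs_pow_mul_exp_le j N hl p.2.2)
    rw [norm_mul, norm_mul, norm_div, norm_mul, norm_pow, norm_pow, norm_pow, norm_pow,
      Complex.norm_real, Complex.norm_real, Real.norm_of_nonneg hl.le,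
      Real.norm_of_nonneg (Real.exp_pos _).le, RCLike.norm_natCast]
    simp only [hvdef, norm_ofReal_mul_I]
    have h4 := exp_neg_mul_scaledCoeff_le (hτ.trans_le hp.1) hl p.2.2
    have h5 : p.2.1 ^ j / (j.factorial : ℝ) ≤ p.2.1 ^ j :=
      div_le_self (by positivity) (by exact_mod_cast Nat.one_le_iff_ne_zero.mpr j.factorial_ne_zero)
    calc _ ≤ (Real.exp (-(p.2.1 * p.2.2 ^ 2 / 4)) * p.2.1 ^ j)
          * ((|p.2.2| ^ 2) ^ j * |p.2.2| ^ (2 * N)) := by gcongr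
      _ = _ := by ring
  refine (IsBigO.fun_sum hterm).congr_left fun p => ?_
  rw [gaussApprox, Finset.mul_sum, Finset.mul_sum, ← Finset.sum_sub_distrib]
  refine Finset.sum_congr rfl fun j _ => ?_
  simp only [hD, hvdef]
  rw [mul_pow (p.2.1 : ℂ)]
  ring

theorem exists_norm_exp_phase_sub_le {τ : ℝ} (hτ : 0 < τ) (N : ℕ) :
    ∃ ε > 0, ε ≤ τ ∧ ∃ K, ∀ t lam y : ℝ, τ ≤ t → 0 < lam → |y| ≤ ε →
      ‖cexp (lam * phase t (y * I)) - gaussApprox N t lam y‖ ≤ K * gaussScale N lam y := by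
  -- This is the cubic remainder constant of `norm_phase_sub_sum_le` at `M = 1`. The bound `ε ≤ 1 /
  -- (4 C)` keeps the non-quadratic part below `lam y² / 4`, half of the guaranteed Gaussian decay.
  set C := Real.exp 1 + 2 / τ ^ 2 with hC
  have hC0 : 0 < C := by positivity
  refine ⟨min (min 1 (τ / 2)) (1 / (4 * C)), by positivity,
    ((min_le_left _ _).trans (min_le_right _ _)).trans (by linarith), ?_⟩
  set ε := min (min 1 (τ / 2)) (1 / (4 * C)) with hε
  have hε1 : ε ≤ 1 := (min_le_left _ _).trans (min_le_left _ _)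
  have hε2 : ε ≤ τ / 2 := (min_le_left _ _).trans (min_le_right _ _)
  have hε3 : ε ≤ 1 / (4 * C) := min_le_right _ _
  obtain ⟨K, hK⟩ := exists_local_remainder_bound hτ N hε1 hε2
  refine ⟨C ^ (2 * N) * (8 ^ (2 * N + N) * (2 * N + N).factorial) + K, fun t lam y ht hl hy => ?_⟩
  have ht0 := hτ.trans_le ht
  have hK' := hK (t, lam, y) ⟨ht, hl, hy⟩
  simp only at hK'
  have hpos : 0 < gaussScale N lam y := by rw [gaussScale]; positivity
  rw [Real.norm_of_nonneg hpos.le] at hK'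
  set w : ℂ := lam * (phase t (y * I) - scaledCoeff t 0 * (y * I) ^ 2) with hw
  have hexp : cexp (lam * phase t (y * I))
      = Real.exp (-(lam * scaledCoeff t 0 * y ^ 2)) * cexp w := by
    rw [Complex.ofReal_exp, ← Complex.exp_add, hw]
    congr 1
    rw [mul_pow, I_sq]
    push_cast
    ring
  have hwn : ‖w‖ ≤ lam * (C * |y| ^ 3) := by
    rw [hw, norm_mul, Complex.norm_real, Real.norm_of_nonneg hl.le]
    have h := norm_phase_sub_sum_le hτ ht (v := y * I)
      (by rw [norm_ofReal_mul_I]; exact hy.trans hε1)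
      (by rw [norm_ofReal_mul_I]; exact hy.trans hε2) 1
    rw [norm_ofReal_mul_I, Finset.sum_range_one] at h
    gcongr
  have hCy : C * |y| ≤ 1 / 4 := by
    calc C * |y| ≤ C * (1 / (4 * C)) := by gcongr; exact hy.trans hε3
      _ = 1 / 4 := by field_simp
  have hwn2 : ‖w‖ ≤ lam * y ^ 2 / 4 := by
    refine hwn.trans ?_
    calc lam * (C * |y| ^ 3) = lam * |y| ^ 2 * (C * |y|) := by ring
      _ ≤ lam * |y| ^ 2 * (1 / 4) := by gcongr
      _ = _ := by rw [sq_abs]; ring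
  have hrem : ‖cexp (lam * phase t (y * I)) - Real.exp (-(lam * scaledCoeff t 0 * y ^ 2)) *
      ∑ j ∈ Finset.range (2 * N), w ^ j / j.factorial‖
      ≤ C ^ (2 * N) * (8 ^ (2 * N + N) * (2 * N + N).factorial) * gaussScale N lam y := by
    rw [hexp, ← mul_sub, norm_mul, Complex.norm_real, Real.norm_of_nonneg (Real.exp_pos _).le]
    have h1 := Complex.norm_exp_sub_sum_le_norm_mul_exp w (2 * N)
    have h2 : Real.exp (-(lam * scaledCoeff t 0 * y ^ 2)) * Real.exp ‖w‖
        ≤ Real.exp (-(lam * y ^ 2 / 4)) := by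
      rw [← Real.exp_add]
      refine Real.exp_le_exp.mpr ?_
      have h3 := half_le_scaledCoeff_zero ht0
      have h4 : 0 ≤ lam * y ^ 2 := by positivity
      nlinarith
    calc _ ≤ Real.exp (-(lam * scaledCoeff t 0 * y ^ 2)) * (‖w‖ ^ (2 * N) * Real.exp ‖w‖) := by
          gcongr
      _ = ‖w‖ ^ (2 * N) * (Real.exp (-(lam * scaledCoeff t 0 * y ^ 2)) * Real.exp ‖w‖) := by ring
      -- Keeping `2N` exponential terms is enough: `(lam |y|³) ^ (2N)` has size `lam ^ (-N)` on the
      -- scale `y² ~ 1 / lam`.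
      _ ≤ (lam * (C * |y| ^ 3)) ^ (2 * N) * Real.exp (-(lam * y ^ 2 / 4)) := by gcongr
      _ = C ^ (2 * N) * (lam ^ (2 * N) * |y| ^ (2 * (2 * N + N))
          * Real.exp (-(lam * y ^ 2 / 4))) := by
        rw [mul_pow, mul_pow, ← pow_mul]; ring_nf
      _ ≤ C ^ (2 * N) * ((8 ^ (2 * N + N) * (2 * N + N).factorial) * gaussScale N lam y) := by
        exact mul_le_mul_of_nonneg_left (pow_mul_abs_pow_mul_exp_le (2 * N) N hl y)
          (by positivity)
      _ = _ := by ring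
  rw [add_mul]
  refine le_trans ?_ (add_le_add hrem hK')
  exact norm_sub_le_norm_sub_add_norm_sub _ _ _

/-- Since `|y| > ε`, every `|y| ^ k` with `k < 2N` is at most a constant times `|y| ^ (2N)`, and the
same absorption applies. -/
theorem exists_norm_gaussApprox_le {τ : ℝ} (hτ : 0 < τ) (N : ℕ) {ε : ℝ} (hε : 0 < ε) :
    ∃ K, ∀ t lam y : ℝ, τ ≤ t → 0 < lam → ε < |y| →
      ‖gaussApprox N t lam y‖ ≤ K * gaussScale N lam y := by
  have hb : ∀ r, (fun t : ℝ => scaledCoeff t r) =O[𝓟 (Set.Ici τ)] fun _ => (1 : ℝ) := by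
    intro r
    rw [isBigO_principal]
    exact ⟨1 + 1 / τ ^ (r + 1), fun t ht => by simpa using abs_scaledCoeff_le hτ ht r⟩
  have hbell : ∀ j k, ∃ B, 0 ≤ B ∧ ∀ t, τ ≤ t → |bell (scaledCoeff t) j k| ≤ B := by
    intro j k
    obtain ⟨B, hB⟩ := isBigO_principal.mp (bell_isBigO_one hb j k)
    refine ⟨|B|, abs_nonneg _, fun t ht => ?_⟩
    have := hB t ht
    simp only [Real.norm_eq_abs, abs_one, mul_one] at this
    exact this.trans (le_abs_self B)
  choose B hB0 hB using hbell
  refine ⟨∑ j ∈ Finset.range (2 * N), ∑ k ∈ Finset.range (2 * N),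
    B j k * (ε ^ (2 * N - k))⁻¹ * (8 ^ (j + N) * (j + N).factorial), fun t lam y ht hl hy => ?_⟩
  have ht0 := hτ.trans_le ht
  rw [gaussApprox, Finset.mul_sum, Finset.sum_mul]
  refine norm_sum_le_of_le _ fun j _ => ?_
  rw [Finset.mul_sum, Finset.mul_sum, Finset.sum_mul]
  refine norm_sum_le_of_le _ fun k hk => ?_
  rw [norm_mul, norm_mul, norm_mul, norm_mul, norm_div, norm_pow, norm_pow, norm_pow, norm_pow,
    Complex.norm_real, Complex.norm_real, Complex.norm_real, Real.norm_of_nonneg hl.le,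
    Real.norm_of_nonneg (Real.exp_pos _).le, RCLike.norm_natCast, norm_ofReal_mul_I,
    Real.norm_eq_abs]
  have h4 := exp_neg_mul_scaledCoeff_le ht0 hl y
  have h5 : lam ^ j / (j.factorial : ℝ) ≤ lam ^ j :=
    div_le_self (by positivity) (by exact_mod_cast Nat.one_le_iff_ne_zero.mpr j.factorial_ne_zero)
  have hk2 : 2 * N = (2 * N - k) + k := by have := Finset.mem_range.mp hk; omega
  have h6 : |y| ^ k ≤ (ε ^ (2 * N - k))⁻¹ * |y| ^ (2 * N) := by
    rw [le_inv_mul_iff₀ (by positivity)]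
    calc ε ^ (2 * N - k) * |y| ^ k ≤ |y| ^ (2 * N - k) * |y| ^ k := by gcongr
      _ = _ := by rw [← pow_add, ← hk2]
  calc _ ≤ Real.exp (-(lam * y ^ 2 / 4)) * (lam ^ j * (|y| ^ 2) ^ j *
        (B j k * ((ε ^ (2 * N - k))⁻¹ * |y| ^ (2 * N)))) := by
        have := hB j k t ht
        have := hB0 j k
        rw [mul_assoc (lam ^ j / (j.factorial : ℝ)), mul_assoc (lam ^ j)]
        gcongr
    _ = B j k * (ε ^ (2 * N - k))⁻¹ * (lam ^ j * |y| ^ (2 * (j + N))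
          * Real.exp (-(lam * y ^ 2 / 4))) := by ring
    _ ≤ B j k * (ε ^ (2 * N - k))⁻¹ * ((8 ^ (j + N) * (j + N).factorial)
          * gaussScale N lam y) := by
        have := hB0 j k
        exact mul_le_mul_of_nonneg_left (pow_mul_abs_pow_mul_exp_le j N hl y) (by positivity)
    _ = _ := by ring

end LocalExpansion

/-! ### The saddle integral: tails and Gaussian moments -/

section SaddleIntegral

theorem one_add_mul_I_div_ne_zero {t : ℝ} (ht : 0 < t) (y : ℝ) : (1 : ℂ) + y * I / t ≠ 0 := by
  have htC : (t : ℂ) ≠ 0 := by exact_mod_cast ht.ne'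
  intro h
  apply add_mul_I_ne_zero ht y
  field_simp at h
  simpa using h

theorem cexp_phase_eq {t : ℝ} (ht : 0 < t) (n : ℕ) (y : ℝ) :
    cexp ((n / t : ℝ) * phase t (y * I))
      = cexp ((n / t : ℝ) * (cexp (y * I) - 1)) / (1 + y * I / t) ^ n := by
  have htC : (t : ℂ) ≠ 0 := by exact_mod_cast ht.ne'
  have h : ((n / t : ℝ) : ℂ) * phase t (y * I)
      = (n / t : ℝ) * (cexp (y * I) - 1) - n * log (1 + y * I / t) := by
    rw [phase]; push_cast; field_simp
  rw [h, Complex.exp_sub, Complex.exp_nat_mul, Complex.exp_log (one_add_mul_I_div_ne_zero ht y)]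

theorem cexp_phase_eq_div_pow {t : ℝ} (ht : 0 < t) (n : ℕ) (y : ℝ) :
    cexp ((n / t : ℝ) * phase t (y * I))
      = t ^ n * cexp ((n / t : ℝ) * (cexp (y * I) - 1)) / ((t : ℂ) + y * I) ^ n := by
  have htC : (t : ℂ) ≠ 0 := by exact_mod_cast ht.ne'
  have h : (t : ℂ) + y * I = t * (1 + y * I / t) := by field_simp
  have h2 := pow_ne_zero n (one_add_mul_I_div_ne_zero ht y)
  rw [cexp_phase_eq ht, h, mul_pow]
  field_simp

theorem norm_cexp_mul_cexp_sub_one_le {lam : ℝ} (hl : 0 ≤ lam) (y : ℝ) :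
    ‖cexp (lam * (cexp (y * I) - 1))‖ ≤ 1 := by
  rw [Complex.norm_exp, Real.exp_le_one_iff, Complex.re_ofReal_mul, Complex.sub_re,
    Complex.exp_ofReal_mul_I_re, Complex.one_re]
  have := Real.cos_le_one y
  nlinarith

theorem integrable_cexp_phase {t : ℝ} (ht : 0 < t) {n : ℕ} (hn : 2 ≤ n) :
    Integrable fun y : ℝ => cexp ((n / t : ℝ) * phase t (y * I)) := by
  simp_rw [cexp_phase_eq_div_pow ht n]
  refine integrable_div_pow ht hn (by fun_prop) (B := t ^ n) fun y => ?_
  rw [norm_mul, norm_pow, Complex.norm_real, Real.norm_of_nonneg ht.le]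
  exact mul_le_of_le_one_right (by positivity) (norm_cexp_mul_cexp_sub_one_le (by positivity) y)

theorem T_eq_integral_phase {n : ℕ} (hn : 2 ≤ n) {x t : ℝ} (hx : 0 < x) (ht : 0 < t)
    (h : t * Real.exp t = n / x) :
    (T (n - 1) x : ℂ) = ((n - 1).factorial * Real.exp (-x) * Real.exp (n / t) / t ^ n
      / (2 * Real.pi) : ℝ) * ∫ y : ℝ, cexp ((n / t : ℝ) * phase t (y * I)) := by
  rw [T_eq_integral hn hx ht]
  have hxt : x * Real.exp t = n / t := by
    field_simp at h ⊢; linarith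
  have htC : (t : ℂ) ≠ 0 := by exact_mod_cast ht.ne'
  have hpt : ∀ y : ℝ, cexp (x * cexp ((t : ℂ) + y * I)) / ((t : ℂ) + y * I) ^ n
      = ((Real.exp (n / t) / t ^ n : ℝ) : ℂ) * cexp ((n / t : ℝ) * phase t (y * I)) := by
    intro y
    have h1 : (x : ℂ) * cexp ((t : ℂ) + y * I)
        = ((n / t : ℝ) : ℂ) + (n / t : ℝ) * (cexp (y * I) - 1) := by
      rw [Complex.exp_add, ← Complex.ofReal_exp, ← mul_assoc, ← Complex.ofReal_mul, hxt]; ring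
    rw [cexp_phase_eq_div_pow ht, h1, Complex.exp_add]
    push_cast
    field_simp
  simp_rw [hpt]
  rw [integral_const_mul]
  push_cast
  ring

/-- With `z = ε² / (4t²)`, the modulus of `1 + iy/t` is at least `e^z`. Of the `n` factors in the
denominator, `n - 2` give the exponential and two are kept for integrability. -/
theorem norm_cexp_phase_le {t ε : ℝ} (ht : 0 < t) (hε : 0 < ε) (hεt : ε ≤ t) {n : ℕ} (hn : 2 ≤ n)
    {y : ℝ} (hy : ε < |y|) :
    ‖cexp ((n / t : ℝ) * phase t (y * I))‖
      ≤ Real.exp (-(ε ^ 2 * (n - 2) / (4 * t ^ 2))) * (1 + (y / t) ^ 2)⁻¹ := by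
  set q : ℝ := ‖(1 : ℂ) + y * I / t‖ with hq
  have hq2 : q ^ 2 = 1 + (y / t) ^ 2 := by
    have : (1 : ℂ) + y * I / t = ((1 : ℝ) : ℂ) + ((y / t : ℝ) : ℂ) * I := by push_cast; ring
    rw [hq, this, ← Complex.normSq_eq_norm_sq, Complex.normSq_add_mul_I]; ring
  have hq0 : 0 < q := norm_pos_iff.mpr (one_add_mul_I_div_ne_zero ht y)
  set z : ℝ := ε ^ 2 / (4 * t ^ 2) with hz
  have hz0 : 0 ≤ z := by positivity
  have hz1 : 4 * z ≤ 1 := by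
    have : 4 * z = (ε / t) ^ 2 := by rw [hz]; field_simp
    rw [this]
    exact pow_le_one₀ (by positivity) ((div_le_one ht).mpr hεt)
  have hqz : Real.exp z ≤ q := by
    refine le_of_sq_le_sq ?_ hq0.le
    rw [hq2, ← Real.exp_nat_mul]
    have h1 : 4 * z ≤ (y / t) ^ 2 := by
      have : 4 * z = (ε / t) ^ 2 := by rw [hz]; field_simp
      rw [this, div_pow, div_pow, ← sq_abs y]
      gcongr
    have h2 : Real.exp (((2 : ℕ) : ℝ) * z) * (1 - 2 * z) ≤ 1 := by
      have h3 := Real.add_one_le_exp (-(2 * z))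
      have h4 : Real.exp (((2 : ℕ) : ℝ) * z) * Real.exp (-(2 * z)) = 1 := by
        rw [← Real.exp_add]; simp
      rw [← h4]
      gcongr
      linarith
    -- The right side is `1 + 2z (1 - 4z)`, and `4z ≤ 1` because `ε ≤ t`.
    have h5 : 1 ≤ (1 + 4 * z) * (1 - 2 * z) := by nlinarith
    have h6 : Real.exp (((2 : ℕ) : ℝ) * z) ≤ 1 + 4 * z :=
      le_of_mul_le_mul_right (h2.trans h5) (by linarith)
    exact h6.trans (by linarith)
  obtain ⟨k, rfl⟩ := Nat.exists_eq_add_of_le' hn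
  have hexp : Real.exp (-(ε ^ 2 * ((k + 2 : ℕ) - 2) / (4 * t ^ 2))) = ((Real.exp z) ^ k)⁻¹ := by
    rw [← Real.exp_nat_mul, ← Real.exp_neg, hz]
    congr 1
    push_cast; ring
  rw [cexp_phase_eq ht, norm_div, norm_pow, hexp, ← hq2, ← mul_inv, pow_add,
    div_eq_mul_inv]
  refine (mul_le_of_le_one_left (by positivity)
    (norm_cexp_mul_cexp_sub_one_le (by positivity) y)).trans ?_
  gcongr

theorem integrable_pow_mul_exp_neg_mul_sq {b : ℝ} (hb : 0 < b) (m : ℕ) :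
    Integrable fun y : ℝ => y ^ m * Real.exp (-(b * y ^ 2)) := by
  have h := integrable_rpow_mul_exp_neg_mul_sq hb (s := m)
    (by have := Nat.cast_nonneg (α := ℝ) m; linarith)
  simpa [Real.rpow_natCast] using h

theorem integral_even_pow_mul_exp_neg_mul_sq {b : ℝ} (hb : 0 < b) (m : ℕ) :
    ∫ y : ℝ, y ^ (2 * m) * Real.exp (-(b * y ^ 2))
      = Real.Gamma (m + 1 / 2) / (b ^ m * Real.sqrt b) := by
  have h1 : ∀ y : ℝ, y ^ (2 * m) * Real.exp (-(b * y ^ 2))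
      = |y| ^ (2 * m) * Real.exp (-(b * |y| ^ 2)) := by
    intro y; rw [pow_mul, pow_mul, sq_abs]
  rw [integral_congr_ae (ae_of_all _ h1)]
  rw [integral_comp_abs (f := fun u => u ^ (2 * m) * Real.exp (-(b * u ^ 2)))]
  have h2 := integral_rpow_mul_exp_neg_mul_rpow (p := 2) (q := (2 * m : ℕ)) (b := b) two_pos
    (by have := Nat.cast_nonneg (α := ℝ) (2 * m); linarith) hb
  have h3 : ∫ u in Set.Ioi (0 : ℝ), u ^ (2 * m) * Real.exp (-(b * u ^ 2))
      = ∫ u in Set.Ioi (0 : ℝ), u ^ ((2 * m : ℕ) : ℝ) * Real.exp (-b * u ^ (2 : ℝ)) := by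
    refine setIntegral_congr_fun measurableSet_Ioi fun u _ => ?_
    simp only [Real.rpow_natCast]
    rw [show (2 : ℝ) = ((2 : ℕ) : ℝ) by norm_num, Real.rpow_natCast, neg_mul]
  rw [h3, h2]
  have h4 : (((2 * m : ℕ) : ℝ) + 1) / 2 = m + 1 / 2 := by push_cast; ring
  have h5 : -(((2 * m : ℕ) : ℝ) + 1) / 2 = -((m : ℝ) + 1 / 2) := by push_cast; ring
  rw [h4, h5, Real.rpow_neg hb.le, Real.rpow_add hb, Real.rpow_natCast, ← Real.sqrt_eq_rpow]
  ring

theorem gamma_add_nat {s : ℝ} (hs : 0 < s) (j : ℕ) :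
    Real.Gamma (s + j) = Real.Gamma s * (ascPochhammer ℝ j).eval s := by
  induction j with
  | zero => simp
  | succ j ih =>
    have : s + j ≠ 0 := by positivity
    rw [ascPochhammer_succ_eval, ← mul_assoc, ← ih, Nat.cast_succ, ← add_assoc,
      Real.Gamma_add_one this, mul_comm]

theorem sum_range_two_mul {E : Type*} [AddCommMonoid E] (f : ℕ → E) (N : ℕ) :
    ∑ k ∈ Finset.range (2 * N), f k = ∑ s ∈ Finset.range N, (f (2 * s) + f (2 * s + 1)) := by
  induction N with
  | zero => simp
  | succ N ih =>
    rw [Finset.sum_range_succ, ← ih, Nat.mul_succ, Finset.sum_range_succ, Finset.sum_range_succ,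
      add_assoc]

/-- Odd powers of `iy` are purely imaginary, so only `k = 2s` survives; this is why just the
`c_{2s}` occur. -/
theorem re_gaussApprox (N : ℕ) (t lam y : ℝ) :
    (gaussApprox N t lam y).re = ∑ s ∈ Finset.range N, ∑ j ∈ Finset.range (2 * N),
      (lam ^ j / j.factorial * bell (scaledCoeff t) j (2 * s) * (-1) ^ (j + s)) *
        (y ^ (2 * (j + s)) * Real.exp (-(lam * scaledCoeff t 0 * y ^ 2))) := by
  rw [gaussApprox, Complex.re_ofReal_mul, Complex.re_sum, Finset.sum_comm, Finset.mul_sum]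
  refine Finset.sum_congr rfl fun j _ => ?_
  have h1 : ∀ k, ((bell (scaledCoeff t) j k : ℂ) * (y * I) ^ k).re
      = bell (scaledCoeff t) j k * ((y * I : ℂ) ^ k).re := fun k => Complex.re_ofReal_mul _ _
  have hsq : ((y : ℂ) * I) ^ 2 = ((-(y ^ 2) : ℝ) : ℂ) := by rw [mul_pow, I_sq]; push_cast; ring
  have h2 : ∀ s : ℕ, ((y * I : ℂ) ^ (2 * s)).re = (-(y ^ 2)) ^ s := by
    intro s; rw [pow_mul, hsq, ← Complex.ofReal_pow, Complex.ofReal_re]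
  have h3 : ∀ s : ℕ, ((y * I : ℂ) ^ (2 * s + 1)).re = 0 := by
    intro s
    rw [pow_succ, pow_mul, hsq, ← Complex.ofReal_pow, Complex.re_ofReal_mul]
    simp
  have h4 : (lam : ℂ) ^ j / j.factorial * ((y * I) ^ 2) ^ j
      = ((lam ^ j / j.factorial * (-(y ^ 2)) ^ j : ℝ) : ℂ) := by rw [hsq]; push_cast; ring
  rw [h4, Complex.re_ofReal_mul, Complex.re_sum]
  simp_rw [h1]
  rw [sum_range_two_mul, Finset.mul_sum, Finset.mul_sum]
  refine Finset.sum_congr rfl fun s _ => ?_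
  rw [h2, h3, neg_pow (y ^ 2), neg_pow (y ^ 2), ← pow_mul, ← pow_mul, Nat.mul_add, pow_add y,
    pow_add (-1 : ℝ)]
  ring

theorem integrable_gaussApprox (N : ℕ) {t lam : ℝ} (ht : 0 < t) (hl : 0 < lam) :
    Integrable (gaussApprox N t lam) := by
  have hb : 0 < lam * scaledCoeff t 0 := by have := half_le_scaledCoeff_zero ht; positivity
  unfold gaussApprox
  simp_rw [Finset.mul_sum]
  refine integrable_finsetSum _ fun j _ => integrable_finsetSum _ fun k _ => ?_
  have h := ((integrable_pow_mul_exp_neg_mul_sq hb (2 * j + k)).ofReal (𝕜 := ℂ)).const_mul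
    ((lam : ℂ) ^ j / j.factorial * (bell (scaledCoeff t) j k : ℂ) * I ^ (2 * j + k))
  refine h.congr (ae_of_all _ fun y => ?_)
  simp only [RCLike.ofReal_mul, RCLike.ofReal_pow, Complex.coe_algebraMap]
  change _ * ((y : ℂ) ^ (2 * j + k) * _) = _
  rw [mul_pow (y : ℂ) I k, ← pow_mul, mul_pow, pow_add I, pow_add (y : ℂ)]
  ring

theorem sqrt_div_eq {t : ℝ} (ht : 0 < t) {n : ℕ} (hn : 0 < n) :
    Real.sqrt (2 * Real.pi * (1 + t)) / (2 * Real.pi * t)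
      = Real.sqrt (n / t * scaledCoeff t 0) / (Real.sqrt n * Real.sqrt Real.pi) := by
  have hpi := Real.pi_pos
  have hn' : (0 : ℝ) < n := by exact_mod_cast hn
  have h : n / t * scaledCoeff t 0 = (2 * Real.pi * (1 + t)) * (n * Real.pi) / (2 * Real.pi * t) ^ 2 := by
    rw [scaledCoeff_zero]; field_simp; ring
  rw [h, Real.sqrt_div (by positivity), Real.sqrt_sq (by positivity),
    Real.sqrt_mul (x := 2 * Real.pi * (1 + t)) (by positivity), Real.sqrt_mul hn'.le]
  field_simp

theorem re_integral_gaussApprox (N : ℕ) {t : ℝ} (ht : 0 < t) {n : ℕ} (hn : 0 < n) :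
    Real.sqrt (2 * Real.pi * (1 + t)) / (2 * Real.pi * t) * (∫ y, gaussApprox N t (n / t) y).re
      = ∑ s ∈ Finset.range N, term n s t := by
  have hn' : (0 : ℝ) < n := by exact_mod_cast hn
  have hl : 0 < (n : ℝ) / t := by positivity
  have hb0 : 0 < scaledCoeff t 0 := by have := half_le_scaledCoeff_zero ht; positivity
  have hb : 0 < n / t * scaledCoeff t 0 := by positivity
  have hre : (∫ y, gaussApprox N t (n / t) y).re = ∫ y, (gaussApprox N t (n / t) y).re :=
    (integral_re (integrable_gaussApprox N ht hl)).symm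
  rw [hre]
  simp_rw [re_gaussApprox]
  rw [integral_finsetSum _ fun s _ => integrable_finsetSum _ fun j _ =>
    (integrable_pow_mul_exp_neg_mul_sq hb _).const_mul _, Finset.mul_sum]
  refine Finset.sum_congr rfl fun s hs => ?_
  rw [integral_finsetSum _ fun j _ => (integrable_pow_mul_exp_neg_mul_sq hb _).const_mul _]
  simp_rw [integral_const_mul, integral_even_pow_mul_exp_neg_mul_sq hb]
  -- `B_{2s,j}` vanishes for `j > 2s`, so the `j`-sum no longer depends on `N`.
  rw [← Finset.sum_subset (s₁ := Finset.range (2 * s + 1))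
    (Finset.range_subset_range.mpr (by have := Finset.mem_range.mp hs; omega))
    (fun j _ hj => by
      rw [bell_eq_zero_of_lt _ (by simpa using hj)]; ring)]
  rw [term, coeff_eq_scaledCoeff ht, sqrt_div_eq ht hn, Real.Gamma_one_half_eq,
    Real.rpow_add hn', Real.rpow_natCast, ← Real.sqrt_eq_rpow]
  simp only [Finset.mul_sum, Finset.sum_mul, Finset.sum_div]
  refine Finset.sum_congr rfl fun j _ => ?_
  have hG : Real.Gamma (((j + s : ℕ) : ℝ) + 1 / 2)
      = Real.Gamma ((s : ℝ) + 1 / 2) * (ascPochhammer ℝ j).eval ((s : ℝ) + 1 / 2) := by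
    rw [← gamma_add_nat (by positivity)]; congr 1; push_cast; ring
  rw [hG]
  have hsb : Real.sqrt (n / t * scaledCoeff t 0) ≠ 0 := (Real.sqrt_pos.mpr hb).ne'
  have hsn : Real.sqrt n ≠ 0 := (Real.sqrt_pos.mpr hn').ne'
  have hsp : Real.sqrt Real.pi ≠ 0 := (Real.sqrt_pos.mpr Real.pi_pos).ne'
  generalize Real.sqrt (n / t * scaledCoeff t 0) = β at hsb ⊢
  generalize Real.Gamma ((s : ℝ) + 1 / 2) = G
  generalize (ascPochhammer ℝ j).eval ((s : ℝ) + 1 / 2) = P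
  generalize bell (scaledCoeff t) j (2 * s) = b
  generalize scaledCoeff t 0 = b0 at hb0 ⊢
  rw [pow_add, pow_add, mul_pow, mul_pow, div_pow, div_pow]
  field_simp

theorem integral_gaussScale (N : ℕ) {lam : ℝ} (hl : 0 < lam) :
    Integrable (gaussScale N lam) ∧
      ∫ y, gaussScale N lam y = (lam ^ N)⁻¹ * Real.sqrt (8 * Real.pi / lam) := by
  have heq : gaussScale N lam = fun y => (lam ^ N)⁻¹ * Real.exp (-(lam / 8) * y ^ 2) := by
    funext y; rw [gaussScale]; ring_nf
  rw [heq]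
  refine ⟨(integrable_exp_neg_mul_sq (by positivity)).const_mul _, ?_⟩
  rw [integral_const_mul, integral_gaussian]
  congr 2
  field_simp

theorem exists_norm_integral_sub_le {τ : ℝ} (hτ : 0 < τ) (N : ℕ) :
    ∃ ε > 0, ∃ K ≥ 0, ∀ t : ℝ, ∀ n : ℕ, τ ≤ t → 2 ≤ n →
      ‖(∫ y : ℝ, cexp ((n / t : ℝ) * phase t (y * I))) - ∫ y, gaussApprox N t (n / t) y‖
        ≤ K * (((n / t : ℝ) ^ N)⁻¹ * Real.sqrt (8 * Real.pi / (n / t)))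
          + Real.exp (-(ε ^ 2 * (n - 2) / (4 * t ^ 2))) * (t * Real.pi) := by
  obtain ⟨ε, hε, hετ, K₁, hK₁⟩ := exists_norm_exp_phase_sub_le hτ N
  obtain ⟨K₂, hK₂⟩ := exists_norm_gaussApprox_le hτ N hε
  refine ⟨ε, hε, |K₁| + |K₂|, by positivity, fun t n ht hn => ?_⟩
  have ht0 := hτ.trans_le ht
  have hn' : (0 : ℝ) < n := by exact_mod_cast (by omega : 0 < n)
  have hl : 0 < (n : ℝ) / t := by positivity
  obtain ⟨hgi, hgv⟩ := integral_gaussScale N hl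
  rw [← integral_sub (integrable_cexp_phase ht0 hn) (integrable_gaussApprox N ht0 hl)]
  have hint : ∫ y : ℝ, (1 + (y / t) ^ 2)⁻¹ = t * Real.pi := by
    rw [Measure.integral_comp_div (fun u : ℝ => (1 + u ^ 2)⁻¹) t, integral_univ_inv_one_add_sq,
      abs_of_pos ht0, smul_eq_mul]
  have hmaj := (hgi.const_mul (|K₁| + |K₂|)).add ((integrable_inv_one_add_div_sq ht0).const_mul
    (Real.exp (-(ε ^ 2 * (n - 2) / (4 * t ^ 2)))))
  refine (norm_integral_le_of_norm_le hmaj (ae_of_all _ fun y => ?_)).trans_eq ?_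
  · have hg : 0 ≤ gaussScale N (n / t) y := by rw [gaussScale]; positivity
    simp only [Pi.add_apply]
    rcases le_or_gt |y| ε with hy | hy
    · refine (hK₁ t (n / t) y ht hl hy).trans ?_
      refine le_add_of_le_of_nonneg ?_ (by positivity)
      gcongr
      linarith [le_abs_self K₁, abs_nonneg K₂]
    · refine (norm_sub_le _ _).trans ?_
      rw [add_comm]
      refine add_le_add ((hK₂ t (n / t) y ht hl hy).trans ?_)
        (norm_cexp_phase_le ht0 hε (hετ.trans ht) hn hy)
      gcongr
      linarith [le_abs_self K₂, abs_nonneg K₁]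
  · change ∫ y, ((|K₁| + |K₂|) * gaussScale N (n / t) y
      + Real.exp (-(ε ^ 2 * (n - 2) / (4 * t ^ 2))) * (1 + (y / t) ^ 2)⁻¹) = _
    rw [integral_add (hgi.const_mul _) ((integrable_inv_one_add_div_sq ht0).const_mul _),
      integral_const_mul, integral_const_mul, hgv, hint]

end SaddleIntegral

/-! ### Negligible tail and final estimate -/

theorem exists_tail_le {τ δ ε : ℝ} (hτ : 0 < τ) (hδ : 0 < δ) (hε : 0 < ε) (N : ℕ) :
    ∃ K ≥ 0, ∀ t : ℝ, ∀ n : ℕ, τ ≤ t → 4 ≤ n → t * Real.exp t ≤ n / δ →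
      Real.sqrt (2 * Real.pi * (1 + t)) / (2 * Real.pi * t) *
        (Real.exp (-(ε ^ 2 * (n - 2) / (4 * t ^ 2))) * (t * Real.pi))
        ≤ K * (1 / Real.sqrt n * (t / n) ^ N) := by
  -- From `t⁴ / 24 ≤ e^t ≤ n / (δ τ)` comes `t² ≤ A √n`, so the tail exponent is at least `c √n`.
  set A := Real.sqrt (24 / (δ * τ)) with hA
  have hA0 : 0 < A := Real.sqrt_pos.mpr (by positivity)
  set c := ε ^ 2 / (8 * A) with hc
  have hc0 : 0 < c := by positivity
  -- The power `(√n) ^ (2N + 4)` covers `n ^ N`, the factor `n` lost in bounding `1 + t`, and a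
  -- spare `n`.
  set L := (2 * N + 4).factorial / c ^ (2 * N + 4) with hL
  have hpi := Real.pi_pos
  refine ⟨Real.pi * (1 + 1 / (δ * τ)) * L / τ ^ N, by positivity, fun t n ht hn hte => ?_⟩
  have ht0 := hτ.trans_le ht
  have hn4 : (4 : ℝ) ≤ n := by exact_mod_cast hn
  have hn0 : (0 : ℝ) < n := by linarith
  set r := Real.sqrt n with hr
  have hr0 : 0 < r := Real.sqrt_pos.mpr hn0
  have hr2 : r ^ 2 = n := Real.sq_sqrt hn0.le
  have hτe : Real.exp t ≤ n / (δ * τ) := by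
    rw [le_div_iff₀ (by positivity)]
    rw [le_div_iff₀ hδ] at hte
    have : τ * Real.exp t ≤ t * Real.exp t := by gcongr
    nlinarith
  have ht1 : 1 + t ≤ n * (1 + 1 / (δ * τ)) := by
    have h1 := Real.add_one_le_exp t
    have h2 : n * (1 + 1 / (δ * τ)) = n + n / (δ * τ) := by ring
    linarith
  have ht2 : t ^ 2 ≤ A * r := by
    have h1 := Real.pow_div_factorial_le_exp t ht0.le 4
    have h2 : t ^ 4 ≤ 24 / (δ * τ) * n := by
      have h3 : t ^ 4 / 24 ≤ n / (δ * τ) := by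
        refine le_trans ?_ hτe
        norm_num [Nat.factorial] at h1
        exact h1
      rw [div_le_iff₀ (by norm_num)] at h3
      calc t ^ 4 ≤ _ := h3
        _ = _ := by ring
    rw [hA, hr, ← Real.sqrt_mul (by positivity)]
    refine Real.le_sqrt_of_sq_le ?_
    rwa [← pow_mul]
  have hexp : Real.exp (-(ε ^ 2 * (n - 2) / (4 * t ^ 2))) ≤ L / r ^ (2 * N + 4) := by
    have h1 : c * r ≤ ε ^ 2 * (n - 2) / (4 * t ^ 2) := by
      rw [le_div_iff₀ (by positivity)]
      calc c * r * (4 * t ^ 2) ≤ c * r * (4 * (A * r)) := by gcongr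
        _ = ε ^ 2 * (r ^ 2 / 2) := by rw [hc]; field_simp; ring
        _ ≤ ε ^ 2 * (n - 2) := by rw [hr2]; gcongr; linarith
    have h2 := Real.pow_div_factorial_le_exp (c * r) (by positivity) (2 * N + 4)
    calc _ ≤ Real.exp (-(c * r)) := Real.exp_le_exp.mpr (neg_le_neg h1)
      _ = (Real.exp (c * r))⁻¹ := Real.exp_neg _
      _ ≤ ((c * r) ^ (2 * N + 4) / (2 * N + 4).factorial)⁻¹ := by gcongr
      _ = _ := by rw [hL, mul_pow]; field_simp
  have hsq : Real.sqrt (2 * Real.pi * (1 + t)) ≤ 2 * Real.pi * (1 + t) := by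
    rw [Real.sqrt_le_self_iff]
    right
    nlinarith [Real.pi_gt_three]
  have hr1 : 1 ≤ r := by rw [hr]; exact Real.one_le_sqrt.mpr (by linarith)
  calc Real.sqrt (2 * Real.pi * (1 + t)) / (2 * Real.pi * t) *
        (Real.exp (-(ε ^ 2 * (n - 2) / (4 * t ^ 2))) * (t * Real.pi))
      = Real.sqrt (2 * Real.pi * (1 + t)) / 2 *
        Real.exp (-(ε ^ 2 * (n - 2) / (4 * t ^ 2))) := by field_simp
    _ ≤ (2 * Real.pi * (n * (1 + 1 / (δ * τ)))) / 2 * (L / r ^ (2 * N + 4)) := by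
        gcongr
        exact hsq.trans (by gcongr)
    _ = Real.pi * (1 + 1 / (δ * τ)) * L / τ ^ N * ((1 / r ^ 2) * (τ / n) ^ N) := by
        rw [div_pow, ← hr2]
        field_simp
        ring
    _ ≤ Real.pi * (1 + 1 / (δ * τ)) * L / τ ^ N * (1 / r * (t / n) ^ N) := by
        gcongr
        nlinarith

theorem leading_nonneg (n : ℕ) (x : ℝ) {t : ℝ} (hn : 0 < n) (ht : 0 < t) : 0 ≤ leading n x t := by
  have : 0 < Real.Gamma n := Real.Gamma_pos_of_pos (by exact_mod_cast hn)
  unfold leading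
  positivity

theorem T_eq_leading_mul {n : ℕ} (hn : 2 ≤ n) {x t : ℝ} (hx : 0 < x) (ht : 0 < t)
    (h : t * Real.exp t = n / x) :
    T (n - 1) x = leading n x t * (Real.sqrt (2 * Real.pi * (1 + t)) / (2 * Real.pi * t) *
      (∫ y : ℝ, cexp ((n / t : ℝ) * phase t (y * I))).re) := by
  have h1 := congrArg Complex.re (T_eq_integral_phase hn hx ht h)
  rw [Complex.ofReal_re, Complex.re_ofReal_mul] at h1
  rw [h1, leading]
  obtain ⟨m, rfl⟩ : ∃ m, n = m + 1 := ⟨n - 1, by omega⟩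
  have hG : Real.Gamma ((m + 1 : ℕ) : ℝ) = m.factorial := by
    push_cast; exact Real.Gamma_nat_eq_factorial m
  have hs : Real.sqrt (2 * Real.pi * (1 + t)) ≠ 0 :=
    (Real.sqrt_pos.mpr (by have := Real.pi_pos; positivity)).ne'
  have hpi := Real.pi_ne_zero
  rw [hG, Nat.add_sub_cancel, Real.exp_add]
  generalize (∫ y : ℝ, cexp (((m + 1 : ℕ) / t : ℝ) * phase t (y * I))).re = J
  field_simp
  ring

theorem exists_abs_T_sub_le {τ δ : ℝ} (hτ : 0 < τ) (hδ : 0 < δ) (N : ℕ) :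
    ∃ K : ℝ, ∀ n : ℕ, 4 ≤ n → ∀ x t : ℝ, δ ≤ x → τ ≤ t → t * Real.exp t = n / x →
      |T (n - 1) x - leading n x t * ∑ s ∈ Finset.range N, term n s t|
        ≤ K * (leading n x t / (n : ℝ) ^ (1 / 2 : ℝ) * (t / n) ^ N) := by
  obtain ⟨ε, hε, K₁, hK₁0, hK₁⟩ := exists_norm_integral_sub_le hτ N
  obtain ⟨K₂, hK₂0, hK₂⟩ := exists_tail_le hτ hδ hε N
  refine ⟨K₁ * Real.sqrt (8 * (1 / 2 + 1 / (2 * τ))) + K₂, fun n hn x t hx ht hxt => ?_⟩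
  have hx0 := hδ.trans_le hx
  have ht0 := hτ.trans_le ht
  have hn0 : (0 : ℝ) < n := by exact_mod_cast (by omega : 0 < n)
  have hpi := Real.pi_pos
  have hlead := leading_nonneg n x (by omega : 0 < n) ht0
  have h1 := hK₁ t n ht (by omega)
  have h2 := hK₂ t n ht hn (by rw [hxt]; gcongr)
  rw [T_eq_leading_mul (by omega) hx0 ht0 hxt, ← re_integral_gaussApprox N ht0 (by omega : 0 < n),
    ← mul_sub, ← mul_sub, ← Complex.sub_re, abs_mul, abs_mul, abs_of_nonneg hlead,
    ← Real.sqrt_eq_rpow]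
  set J := (∫ y : ℝ, cexp ((n / t : ℝ) * phase t (y * I))) - ∫ y, gaussApprox N t (n / t) y
  set pre := Real.sqrt (2 * Real.pi * (1 + t)) / (2 * Real.pi * t) with hpre
  have hpre0 : 0 ≤ pre := by positivity
  rw [abs_of_nonneg hpre0]
  have hb : scaledCoeff t 0 ≤ 1 / 2 + 1 / (2 * τ) := by
    rw [scaledCoeff_zero]; gcongr
  have hb0 := half_le_scaledCoeff_zero ht0
  have hmain : pre * (K₁ * (((n / t : ℝ) ^ N)⁻¹ * Real.sqrt (8 * Real.pi / (n / t))))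
      ≤ K₁ * Real.sqrt (8 * (1 / 2 + 1 / (2 * τ))) * (1 / Real.sqrt n * (t / n) ^ N) := by
    have h3 : Real.sqrt (n / t * scaledCoeff t 0) * Real.sqrt (8 * Real.pi / (n / t))
        = Real.sqrt (8 * scaledCoeff t 0) * Real.sqrt Real.pi := by
      rw [← Real.sqrt_mul (by positivity), ← Real.sqrt_mul (by positivity)]
      congr 1
      field_simp
    have hsn : Real.sqrt n ≠ 0 := (Real.sqrt_pos.mpr hn0).ne'
    have hsp : Real.sqrt Real.pi ≠ 0 := (Real.sqrt_pos.mpr hpi).ne'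
    have h4 : ((n / t : ℝ) ^ N)⁻¹ = (t / n) ^ N := by rw [← inv_pow, inv_div]
    rw [hpre, sqrt_div_eq ht0 (by omega : 0 < n), h4]
    calc _ = K₁ * ((Real.sqrt (n / t * scaledCoeff t 0) * Real.sqrt (8 * Real.pi / (n / t)))
          / (Real.sqrt n * Real.sqrt Real.pi)) * (t / n) ^ N := by ring
      _ = K₁ * Real.sqrt (8 * scaledCoeff t 0) * (1 / Real.sqrt n * (t / n) ^ N) := by
        rw [h3]; field_simp
      _ ≤ _ := by gcongr
  calc leading n x t * (pre * |J.re|)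
      ≤ leading n x t * (pre * (K₁ * (((n / t : ℝ) ^ N)⁻¹ * Real.sqrt (8 * Real.pi / (n / t)))
          + Real.exp (-(ε ^ 2 * (n - 2) / (4 * t ^ 2))) * (t * Real.pi))) := by
        gcongr
        exact (Complex.abs_re_le_norm J).trans h1
    _ ≤ leading n x t * (K₁ * Real.sqrt (8 * (1 / 2 + 1 / (2 * τ)))
          * (1 / Real.sqrt n * (t / n) ^ N) + K₂ * (1 / Real.sqrt n * (t / n) ^ N)) := by
        rw [mul_add]
        gcongr
    _ = _ := by ring

end Touchard

end


theorem theorem1 :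
    -- the positive root `t₀ = W(μ)` of `t e^t = μ` exists and is unique
    (∀ μ : ℝ, 0 < μ → ∃! t : ℝ, 0 < t ∧ t * Real.exp t = μ) ∧
    -- the first coefficients
    (∀ t : ℝ, 0 < t →
      Touchard.coeff 0 t = 1 ∧
      Touchard.coeff 1 t = -Touchard.P2 t / (12 * (1 + t) ^ 3) ∧
      Touchard.coeff 2 t = Touchard.P4 t / (864 * (1 + t) ^ 6)) ∧
    -- the expansion to any order `N`, uniformly for `δ ≤ x ≤ C n`
    (∀ δ C : ℝ, 0 < δ → 0 < C → ∀ N : ℕ, ∃ K : ℝ, ∀ᶠ n : ℕ in atTop,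
      ∀ x t : ℝ, δ ≤ x → x ≤ C * n → 0 < t → t * Real.exp t = n / x →
        |Touchard.T (n - 1) x
            - Touchard.leading n x t * ∑ s ∈ Finset.range N, Touchard.term n s t|
          ≤ K * (Touchard.leading n x t / (n : ℝ) ^ (1 / 2 : ℝ) * (t / n) ^ N)) := by
  refine ⟨fun μ hμ => Touchard.existsUnique_mul_exp_eq hμ,
    fun t ht => ⟨Touchard.coeff_zero t, Touchard.coeff_one ht, Touchard.coeff_two ht⟩,
    fun δ C hδ hC N => ?_⟩
  -- Here `τ = W(1 / C)`: from `x ≤ C n` follows `n / x ≥ 1 / C`, hence `t ≥ τ` by monotonicity.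
  obtain ⟨τ, ⟨hτ, hτe⟩, -⟩ := Touchard.existsUnique_mul_exp_eq (one_div_pos.mpr hC)
  obtain ⟨K, hK⟩ := Touchard.exists_abs_T_sub_le hτ hδ N
  refine ⟨K, ?_⟩
  filter_upwards [eventually_ge_atTop 4] with n hn x t hδx hxC ht hte
  refine hK n hn x t hδx ?_ hte
  refine (Touchard.mul_exp_strictMonoOn.le_iff_le (Set.mem_Ici.mpr hτ.le)
    (Set.mem_Ici.mpr ht.le)).mp ?_
  have hx0 := hδ.trans_le hδx
  change τ * Real.exp τ ≤ t * Real.exp t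
  rw [hτe, hte, div_le_div_iff₀ hC hx0]
  linarith
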